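/- Let $m,n\ge 2$ be integers, $N=m+n$, $a_N=\frac{4(N-1)}{N-2}$, $p=\frac{2N}{N-2}$, and let $s_g>0$ be a real number (the constant scalar curvature of a closed Riemannian $m$-manifold $(M,g)$, for instance $s_g=m(m-1)$). Let $f:\mathbb R^n\to\mathbb R$ be the positive $C^2$ solution of $$-a_N\,\Delta f+s_g f=s_g f^{p-1}\quad\text{on }\mathbb R^n$$ that is radial about the origin and tends to $0$ at infinity. Let $L^2_1(\mathbb R^n)$ be the Sobolev space of functions in $L^2(\mathbb R^n)$ whose weak gradient is in $L^2$. Then for each $\lambda\ge 0$ the number $$A(\lambda)=\inf_{b\in L^2_1(\mathbb R^n)\setminus\{0\}}\left(\frac{\int_{\mathbb R^n}\left(a_N|\nabla b|^2+s_g b^2\right)}{\int_{\mathbb R^n}f^{p-2}b^2}+\lambda\,\frac{\int_{\mathbb R^n}b^2}{\int_{\mathbb R^n}f^{p-2}b^2}\right)$$ satisfies $A(\lambda)\ge s_g\,f(0)^{2-p}$, and the infimum is attained by some nonzero $b\in L^2_1(\mathbb R^n)$ that is radial and decreasing, i.e. $b(y)\le b(x)$ whenever $|x|\le|y|$. -/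

import Mathlib

open MeasureTheory Filter Topology
open scoped ContDiff Laplacian InnerProductSpace

noncomputable section

namespace EuclideanYamabe

/-- Euclidean space `ℝⁿ` with its Euclidean norm. -/
abbrev E (n : ℕ) : Type := EuclideanSpace ℝ (Fin n)

/-- The constant `a_N = 4(N-1)/(N-2)`. -/
def a (N : ℕ) : ℝ := 4 * ((N : ℝ) - 1) / ((N : ℝ) - 2)

/-- The exponent `p_N = 2N/(N-2)`. -/
def p (N : ℕ) : ℝ := 2 * (N : ℝ) / ((N : ℝ) - 2)

/-- `f` is the function `f_K^{m,n,s}` on `ℝⁿ`: the positive classical solution of the Yamabe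
equation `-a_{m+n} Δf + s f = s f^{p-1}`, `p = p_{m+n}`, that vanishes at infinity, translated so
that it is radial about the origin. -/
structure IsYamabeSolution (m n : ℕ) (s : ℝ) (f : E n → ℝ) : Prop where
  contDiff : ContDiff ℝ 2 f
  pos : ∀ x, 0 < f x
  tendsto_zero : Tendsto f (cocompact (E n)) (𝓝 0)
  radial : ∀ x y, ‖x‖ = ‖y‖ → f x = f y
  equation : ∀ x, -a (m + n) * (Δ f) x + s * f x = s * f x ^ (p (m + n) - 1)

/-- `G` is a weak gradient of `b` on `ℝⁿ`: for every test function `φ ∈ C_c^∞(ℝⁿ)` and every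
direction `v`, `∫ b ∂_v φ = - ∫ ⟨G, v⟩ φ`. -/
def IsWeakGradient {n : ℕ} (b : E n → ℝ) (G : E n → E n) : Prop :=
  ∀ φ : E n → ℝ, ContDiff ℝ ∞ φ → HasCompactSupport φ → ∀ v : E n,
    ∫ x, b x * fderiv ℝ φ x v = -∫ x, ⟪G x, v⟫_ℝ * φ x

/-- `b` belongs to the Sobolev space `L²₁(ℝⁿ)` and `G` is (a representative of) its gradient:
`b ∈ L²`, and `G ∈ L²` is the weak gradient of `b`, which is unique up to null sets. -/
structure IsSobolev {n : ℕ} (b : E n → ℝ) (G : E n → E n) : Prop where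
  memLp : MemLp b 2
  memLp_grad : MemLp G 2
  weak : IsWeakGradient b G

/-- The quotient
`∫ (a_N |∇b|² + s b²) / ∫ f^{p-2} b² + lam ∫ b² / ∫ f^{p-2} b²`, with `N = m + n`, `p = p_N`, of a
function `b` with gradient `G`. -/
def quotient (m : ℕ) {n : ℕ} (s : ℝ) (f : E n → ℝ) (lam : ℝ) (b : E n → ℝ) (G : E n → E n) : ℝ :=
  (∫ x, (a (m + n) * ‖G x‖ ^ 2 + s * b x ^ 2)) / (∫ x, f x ^ (p (m + n) - 2) * b x ^ 2)
    + lam * ((∫ x, b x ^ 2) / (∫ x, f x ^ (p (m + n) - 2) * b x ^ 2))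

/-- `A(lam)`: the infimum of the quotient over all `b ∈ L²₁(ℝⁿ)` that are nonzero as elements of
`L²₁(ℝⁿ)`, that is, not almost everywhere zero. -/
def A (m : ℕ) {n : ℕ} (s : ℝ) (f : E n → ℝ) (lam : ℝ) : ℝ :=
  sInf {q : ℝ | ∃ (b : E n → ℝ) (G : E n → E n),
    IsSobolev b G ∧ ¬ (b =ᵐ[volume] 0) ∧ q = quotient m s f lam b G}

end EuclideanYamabe

end

/-! Put `V = f^{p-2}` and `μ = (s + lam)/a`. The quotient is `a` times `(∫ |∇b|² + μ ∫ b²) / ∫ V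
b²`, so everything concerns the operator `-Δ + μ` with weight `V`. The solution `f` is radially
decreasing (`antitoneOn_of_radial_equation`), so `V ≤ V(0) = f(0)^{p-2}`. Discarding the gradient
and `lam` terms then gives the lower bound.

The minimizer comes from shooting rather than from compactness. For each `A` let `B_A` be the radial
solution of `Δb = (μ - A V) b` with `b(0) = 1`. Picone's inequality says that if `B_A > 0` then `∫
(|∇φ|² + (μ - A V) φ²) ≥ 0` for all compactly supported `C¹` functions `φ`; hence such `A` are
bounded above. At their supremum `A` the solution is nonnegative by continuity in `A`, and positive
by uniqueness for the ODE. It is also decreasing: if it increased at a point beyond which `μ - A V`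
is positive, slightly larger parameters would still give positive solutions
(`exists_decreasing_radialSolution`).

A positive decreasing solution has finite energy. Testing its equation against a decreasing cutoff
times the solution leaves a boundary term of favourable sign, and `μ - A V` is bounded below by a
positive constant near infinity. In the limit `∫ (|∇b|² + (μ - A V) b²) ≤ 0`. Picone's inequality,
extended to `L²₁` by mollification and cutoff, gives the opposite inequality for every competitor,
so this `b` is a minimizer with value `a A`. -/

open EuclideanYamabe (E IsSobolev)

/-! ### Weighted radial means -/

/-- The weighted mean `∫₀¹ θ^{n-1} w(tθ) dθ`, that is, `t⁻ⁿ ∫₀ᵗ σ^{n-1} w(σ) dσ` for `t ≠ 0`. -/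
noncomputable def radialMean (n : ℕ) (w : ℝ → ℝ) (t : ℝ) : ℝ :=
  ∫ θ in (0 : ℝ)..1, θ ^ (n - 1) * w (t * θ)

/-- Rescaling the integral to `[0, 1]` removes the singularity of `t⁻ⁿ` at the origin, so continuity
holds there as well. -/
lemma continuous_radialMean_param (n : ℕ) {X : Type*} [TopologicalSpace X]
    {w : X → ℝ → ℝ} (hw : Continuous (Function.uncurry w)) {τ : X → ℝ} (hτ : Continuous τ) :
    Continuous fun x => radialMean n (w x) (τ x) := by
  unfold radialMean
  apply intervalIntegral.continuous_parametric_intervalIntegral_of_continuous' (μ := volume)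
    (f := fun x θ => θ ^ (n - 1) * w x (τ x * θ))
  have : Continuous fun z : X × ℝ => Function.uncurry w (z.1, τ z.1 * z.2) :=
    hw.comp (by fun_prop)
  exact (by fun_prop : Continuous fun z : X × ℝ => z.2 ^ (n - 1)).mul this

lemma continuous_radialMean (n : ℕ) {w : ℝ → ℝ} (hw : Continuous w) :
    Continuous (radialMean n w) :=
  continuous_radialMean_param n (w := fun _ => w) (by exact hw.comp continuous_snd) continuous_id

lemma pow_mul_radialMean {n : ℕ} (hn : 1 ≤ n) (w : ℝ → ℝ) (t : ℝ) :
    t ^ n * radialMean n w t = ∫ σ in (0 : ℝ)..t, σ ^ (n - 1) * w σ := by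
  have h := intervalIntegral.smul_integral_comp_mul_left (a := 0) (b := 1)
    (fun σ => σ ^ (n - 1) * w σ) t
  simp only [mul_zero, mul_one, smul_eq_mul] at h
  rw [← h, radialMean, ← intervalIntegral.integral_const_mul, ← intervalIntegral.integral_const_mul]
  congr 1
  ext θ
  obtain ⟨k, rfl⟩ : ∃ k, n = k + 1 := ⟨n - 1, by omega⟩
  simp only [Nat.add_sub_cancel]
  ring

lemma hasDerivAt_pow_mul_radialMean {n : ℕ} (hn : 1 ≤ n) {w : ℝ → ℝ} (hw : Continuous w) (t : ℝ) :
    HasDerivAt (fun t => t ^ n * radialMean n w t) (t ^ (n - 1) * w t) t := by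
  simp_rw [pow_mul_radialMean hn]
  have hc : Continuous fun σ : ℝ => σ ^ (n - 1) * w σ := by fun_prop
  exact intervalIntegral.integral_hasDerivAt_right (hc.intervalIntegrable _ _)
    (hc.stronglyMeasurableAtFilter _ _) hc.continuousAt

lemma radialMean_zero {n : ℕ} (hn : 1 ≤ n) (w : ℝ → ℝ) : n * radialMean n w 0 = w 0 := by
  obtain ⟨k, rfl⟩ : ∃ k, n = k + 1 := ⟨n - 1, by omega⟩
  simp only [radialMean, zero_mul, Nat.add_sub_cancel, intervalIntegral.integral_mul_const,
    integral_pow]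
  push_cast
  field_simp
  simp

/-- For the mean `g` this reads `t g' + n g = w`, the radial form of `div (g(|x|) x) = w(|x|)`. -/
lemma hasDerivAt_radialMean {n : ℕ} (hn : 1 ≤ n) {w : ℝ → ℝ} (hw : Continuous w) {t : ℝ}
    (ht : t ≠ 0) : HasDerivAt (radialMean n w) ((w t - n * radialMean n w t) / t) t := by
  have h1 := hasDerivAt_pow_mul_radialMean hn hw t
  have h2 := (hasDerivAt_pow n t).inv (pow_ne_zero n ht)
  have h3 := h2.mul h1
  have h4 : radialMean n w =ᶠ[𝓝 t]
      (fun t => t ^ n)⁻¹ * (fun t => t ^ n * radialMean n w t) := by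
    filter_upwards [isOpen_ne.mem_nhds ht] with s hs
    have : s ^ n ≠ 0 := pow_ne_zero n hs
    simp only [Pi.mul_apply, Pi.inv_apply]
    field_simp
  refine (h3.congr_of_eventuallyEq h4).congr_deriv ?_
  simp only [Pi.inv_apply]
  obtain ⟨k, rfl⟩ : ∃ k, n = k + 1 := ⟨n - 1, by omega⟩
  simp only [Nat.add_sub_cancel]
  field_simp
  ring

lemma radialMean_sub (n : ℕ) {w v : ℝ → ℝ} (hw : Continuous w) (hv : Continuous v) (t : ℝ) :
    radialMean n (fun σ => w σ - v σ) t = radialMean n w t - radialMean n v t := by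
  unfold radialMean
  rw [← intervalIntegral.integral_sub]
  · simp only [mul_sub]
  all_goals exact Continuous.intervalIntegrable (by fun_prop) _ _

/-- After `θ^{n-1} ≤ 1`, two integrations of `exp (κ σ)` remain, and each gains a factor `1/κ`. A
large `κ` therefore makes the Volterra operator contract in an exponentially weighted norm. -/
lemma abs_integral_mul_radialMean_le (n : ℕ) {h : ℝ → ℝ} {C κ : ℝ}
    (hκ : 0 < κ) (hC : 0 ≤ C) (hb : ∀ σ, 0 ≤ σ → |h σ| ≤ C * Real.exp (κ * σ)) {R : ℝ}
    (hR : 0 ≤ R) :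
    |∫ t in (0 : ℝ)..R, t * radialMean n h t| ≤ C / κ ^ 2 * Real.exp (κ * R) := by
  have inner (t : ℝ) (ht : 0 ≤ t) : |t * radialMean n h t| ≤ C / κ * Real.exp (κ * t) := by
    have hc : Continuous fun θ : ℝ => C * (t * Real.exp (κ * (t * θ))) := by fun_prop
    have hint : ∫ θ in (0 : ℝ)..1, C * (t * Real.exp (κ * (t * θ)))
        = C / κ * Real.exp (κ * (t * 1)) - C / κ * Real.exp (κ * (t * 0)) := by
      apply intervalIntegral.integral_eq_sub_of_hasDerivAt (f := fun θ =>
        C / κ * Real.exp (κ * (t * θ)))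
      · intro x _
        have := (((hasDerivAt_id x).const_mul t).const_mul κ).exp.const_mul (C / κ)
        refine this.congr_deriv ?_
        simp only [id, mul_one]
        field_simp
      · exact hc.intervalIntegrable _ _
    rw [radialMean, ← intervalIntegral.integral_const_mul]
    have : ‖∫ θ in (0 : ℝ)..1, t * (θ ^ (n - 1) * h (t * θ))‖
        ≤ ∫ θ in (0 : ℝ)..1, C * (t * Real.exp (κ * (t * θ))) := by
      apply intervalIntegral.norm_integral_le_of_norm_le zero_le_one
      · refine ae_of_all _ fun θ hθ => ?_
        rw [Real.norm_eq_abs, abs_mul, abs_mul, abs_of_nonneg ht, abs_of_nonneg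
          (pow_nonneg hθ.1.le _)]
        have h1 := hb (t * θ) (mul_nonneg ht hθ.1.le)
        have h2 : θ ^ (n - 1) ≤ 1 := pow_le_one₀ hθ.1.le hθ.2
        have h3 : θ ^ (n - 1) * |h (t * θ)| ≤ 1 * (C * Real.exp (κ * (t * θ))) :=
          mul_le_mul h2 h1 (abs_nonneg _) zero_le_one
        nlinarith
      · exact hc.intervalIntegrable _ _
    rw [Real.norm_eq_abs, hint] at this
    simp only [mul_one, mul_zero, Real.exp_zero] at this
    have : 0 ≤ C / κ := by positivity
    linarith
  have hc : Continuous fun t : ℝ => C / κ * Real.exp (κ * t) := by fun_prop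
  have hint : ∫ t in (0 : ℝ)..R, C / κ * Real.exp (κ * t)
      = C / κ ^ 2 * Real.exp (κ * R) - C / κ ^ 2 * Real.exp (κ * 0) := by
    apply intervalIntegral.integral_eq_sub_of_hasDerivAt (f := fun t =>
      C / κ ^ 2 * Real.exp (κ * t))
    · intro x _
      have := ((hasDerivAt_id x).const_mul κ).exp.const_mul (C / κ ^ 2)
      refine this.congr_deriv ?_
      simp only [id, mul_one]
      field_simp
    · exact hc.intervalIntegrable _ _
  have : ‖∫ t in (0 : ℝ)..R, t * radialMean n h t‖ ≤ ∫ t in (0 : ℝ)..R, C / κ * Real.exp (κ * t) :=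
    intervalIntegral.norm_integral_le_of_norm_le hR
      (ae_of_all _ fun t ht => inner t ht.1.le) (hc.intervalIntegrable _ _)
  rw [Real.norm_eq_abs, hint] at this
  simp only [mul_zero, Real.exp_zero] at this
  have : 0 ≤ C / κ ^ 2 := by positivity
  linarith

/-! ### The radial Volterra equation -/

open BoundedContinuousFunction in
/-- The radial Volterra equation for `Δ b = q b`, `b(0) = 1`, has a solution which depends
continuously on a parameter. -/
theorem exists_radial_solution (n : ℕ) {q : ℝ → ℝ → ℝ} (hq : Continuous (Function.uncurry q))
    {Q : ℝ → ℝ} (hQ : Continuous Q) (hb : ∀ A r, |q A r| ≤ Q A) :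
    ∃ B : ℝ → ℝ → ℝ, Continuous (Function.uncurry B) ∧ ∀ A r,
      B A r = 1 + ∫ t in (0 : ℝ)..|r|, t * radialMean n (fun σ => q A σ * B A σ) t := by
  have hQ0 (A : ℝ) : 0 ≤ Q A := (abs_nonneg _).trans (hb A 0)
  -- The weight is chosen so that `Q / κ² ≤ 1/2`, which becomes the contraction constant.
  set κ : ℝ → ℝ := fun A => 1 + 2 * Q A with hκ
  have hκc : Continuous κ := by fun_prop
  have hκ1 (A : ℝ) : 1 ≤ κ A := by have := hQ0 A; simp only [hκ]; linarith
  have hκQ (A : ℝ) : Q A / κ A ^ 2 ≤ 1 / 2 := by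
    have := hQ0 A
    rw [div_le_div_iff₀ (by have := hκ1 A; positivity) two_pos]
    simp only [hκ]
    nlinarith
  -- the equation for the rescaled unknown `u = exp (-κ |r|) B`
  let L : (ℝ × ℝ → ℝ) → ℝ × ℝ → ℝ := fun u z =>
    ∫ t in (0 : ℝ)..|z.2|, t * radialMean n
      (fun σ => q z.1 σ * (Real.exp (κ z.1 * |σ|) * u (z.1, σ))) t
  have hqA (A : ℝ) : Continuous (q A) := hq.comp (by fun_prop : Continuous fun r => (A, r))
  have hLc (u : ℝ × ℝ → ℝ) (hu : Continuous u) : Continuous (L u) := by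
    apply intervalIntegral.continuous_parametric_intervalIntegral_of_continuous (μ := volume)
      (f := fun (z : ℝ × ℝ) t => t * radialMean n
        (fun σ => q z.1 σ * (Real.exp (κ z.1 * |σ|) * u (z.1, σ))) t) _ (by fun_prop)
    refine continuous_snd.mul ?_
    apply continuous_radialMean_param n (X := (ℝ × ℝ) × ℝ)
      (w := fun z σ => q z.1.1 σ * (Real.exp (κ z.1.1 * |σ|) * u (z.1.1, σ)))
    · refine Continuous.mul ?_ ?_
      · exact hq.comp (by fun_prop : Continuous fun y : ((ℝ × ℝ) × ℝ) × ℝ => (y.1.1.1, y.2))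
      · fun_prop
    · fun_prop
  have hLsub (u v : ℝ × ℝ → ℝ) (hu : Continuous u) (hv : Continuous v) (C : ℝ) (hC : 0 ≤ C)
      (huv : ∀ z, |u z - v z| ≤ C) (z : ℝ × ℝ) :
      |L u z - L v z| ≤ C / 2 * Real.exp (κ z.1 * |z.2|) := by
    obtain ⟨A, r⟩ := z
    have hqc := hqA A
    have hcu : Continuous fun σ => q A σ * (Real.exp (κ A * |σ|) * u (A, σ)) := by fun_prop
    have hcv : Continuous fun σ => q A σ * (Real.exp (κ A * |σ|) * v (A, σ)) := by fun_prop
    have hru := continuous_radialMean n hcu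
    have hrv := continuous_radialMean n hcv
    have : L u (A, r) - L v (A, r) = ∫ t in (0 : ℝ)..|r|, t * radialMean n
        (fun σ => q A σ * (Real.exp (κ A * |σ|) * u (A, σ))
          - q A σ * (Real.exp (κ A * |σ|) * v (A, σ))) t := by
      simp only [L]
      rw [← intervalIntegral.integral_sub ((by fun_prop : Continuous _).intervalIntegrable _ _)
        ((by fun_prop : Continuous _).intervalIntegrable _ _)]
      congr 1
      ext t
      rw [radialMean_sub n hcu hcv]
      ring
    rw [this]
    refine (abs_integral_mul_radialMean_le n (C := Q A * C) (κ := κ A)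
      (by linarith [hκ1 A]) (mul_nonneg (hQ0 A) hC) ?_ (abs_nonneg r)).trans ?_
    · intro σ hσ
      rw [← mul_sub, ← mul_sub, abs_mul, abs_mul, abs_of_nonneg (Real.exp_nonneg _),
        abs_of_nonneg hσ]
      have h1 := mul_le_mul (hb A σ) (huv (A, σ)) (abs_nonneg _) (hQ0 A)
      have := Real.exp_nonneg (κ A * σ)
      nlinarith
    · refine mul_le_mul_of_nonneg_right ?_ (Real.exp_nonneg _)
      have := mul_le_mul_of_nonneg_left (hκQ A) hC
      calc Q A * C / κ A ^ 2 = C * (Q A / κ A ^ 2) := by ring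
        _ ≤ C / 2 := by linarith
  have hL0 (z : ℝ × ℝ) : L 0 z = 0 := by simp [L, radialMean]
  have hexp (z : ℝ × ℝ) : Real.exp (-(κ z.1 * |z.2|)) * Real.exp (κ z.1 * |z.2|) = 1 := by
    rw [← Real.exp_add]; simp
  have hexp1 (z : ℝ × ℝ) : Real.exp (-(κ z.1 * |z.2|)) ≤ 1 :=
    Real.exp_le_one_iff.2 (by have := hκ1 z.1; have := abs_nonneg z.2; simp; positivity)
  -- The contraction acts on bounded continuous functions of the pair `(A, r)`, so its fixed point
  -- is jointly continuous at once.
  let T : (ℝ × ℝ →ᵇ ℝ) → (ℝ × ℝ →ᵇ ℝ) := fun u =>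
    BoundedContinuousFunction.ofNormedAddCommGroup
      (fun z => Real.exp (-(κ z.1 * |z.2|)) * (1 + L u z))
      (by have := hLc u u.continuous; fun_prop) (1 + ‖u‖ / 2) (by
        intro z
        have h1 := hLsub u 0 u.continuous continuous_const ‖u‖ (norm_nonneg _)
          (fun z => by simpa using u.norm_coe_le_norm z) z
        rw [hL0, sub_zero] at h1
        rw [norm_mul, Real.norm_eq_abs, Real.norm_eq_abs, abs_of_nonneg (Real.exp_nonneg _)]
        calc Real.exp (-(κ z.1 * |z.2|)) * |1 + L u z|
            ≤ Real.exp (-(κ z.1 * |z.2|)) * (1 + ‖u‖ / 2 * Real.exp (κ z.1 * |z.2|)) := by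
              gcongr
              exact (abs_add_le _ _).trans (by rw [abs_one]; gcongr)
          _ = Real.exp (-(κ z.1 * |z.2|)) + ‖u‖ / 2 *
              (Real.exp (-(κ z.1 * |z.2|)) * Real.exp (κ z.1 * |z.2|)) := by ring
          _ ≤ 1 + ‖u‖ / 2 := by rw [hexp]; linarith [hexp1 z])
  have hT : ContractingWith (1 / 2) T := by
    refine ⟨by rw [← NNReal.coe_lt_coe]; norm_num, LipschitzWith.of_dist_le_mul fun u v => ?_⟩
    rw [BoundedContinuousFunction.dist_le (by positivity)]
    intro z
    have h1 := hLsub u v u.continuous v.continuous (dist u v) dist_nonneg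
      (fun z => by rw [← Real.dist_eq]; exact dist_coe_le_dist z) z
    have : T u z - T v z = Real.exp (-(κ z.1 * |z.2|)) * (L u z - L v z) := by
      change Real.exp (-(κ z.1 * |z.2|)) * (1 + L u z) -
        Real.exp (-(κ z.1 * |z.2|)) * (1 + L v z) = _
      ring
    rw [Real.dist_eq, this, abs_mul, abs_of_nonneg (Real.exp_nonneg _)]
    calc _ ≤ Real.exp (-(κ z.1 * |z.2|)) * (dist u v / 2 * Real.exp (κ z.1 * |z.2|)) := by gcongr
      _ = dist u v / 2 * (Real.exp (-(κ z.1 * |z.2|)) * Real.exp (κ z.1 * |z.2|)) := by ring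
      _ = _ := by rw [hexp]; simp; ring
  let u := hT.fixedPoint
  have hu : T u = u := hT.fixedPoint_isFixedPt
  refine ⟨fun A r => Real.exp (κ A * |r|) * u (A, r), ?_, fun A r => ?_⟩
  · have : Continuous fun z : ℝ × ℝ => Real.exp (κ z.1 * |z.2|) * u z := by fun_prop
    exact this
  · have h1 : u (A, r) = Real.exp (-(κ A * |r|)) * (1 + L u (A, r)) := by
      conv_lhs => rw [← hu]
      rfl
    have h2 := hexp (A, r)
    simp only at h2
    change Real.exp (κ A * |r|) * u (A, r) = 1 + L u (A, r)
    rw [h1, ← mul_assoc, mul_comm (Real.exp _), h2, one_mul]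

/-! ### Positivity and monotonicity of radial solutions -/

/-- `B` is the radial profile, normalized by `B(0) = 1`, of a solution of `Δ b = q(|x|) b` on `ℝⁿ`,
in integrated form. -/
structure IsRadialSolution (n : ℕ) (q B : ℝ → ℝ) : Prop where
  continuous_coeff : Continuous q
  continuous : Continuous B
  eq_integral : ∀ r, 0 ≤ r → B r = 1 + ∫ t in (0 : ℝ)..r, t * radialMean n (fun σ => q σ * B σ) t

namespace IsRadialSolution

variable {n : ℕ} {q B : ℝ → ℝ}

lemma continuous_mul (h : IsRadialSolution n q B) : Continuous fun σ => q σ * B σ :=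
  h.continuous_coeff.mul h.continuous

lemma continuous_mean (h : IsRadialSolution n q B) :
    Continuous (radialMean n fun σ => q σ * B σ) :=
  continuous_radialMean n h.continuous_mul

lemma apply_zero (h : IsRadialSolution n q B) : B 0 = 1 := by
  rw [h.eq_integral 0 le_rfl]; simp

lemma hasDerivAt (h : IsRadialSolution n q B) {r : ℝ} (hr : 0 < r) :
    HasDerivAt B (r * radialMean n (fun σ => q σ * B σ) r) r := by
  have hc : Continuous fun t => t * radialMean n (fun σ => q σ * B σ) t :=
    continuous_id.mul h.continuous_mean
  have h1 := (intervalIntegral.integral_hasDerivAt_right (hc.intervalIntegrable 0 r)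
    (hc.stronglyMeasurableAtFilter _ _) hc.continuousAt).const_add 1
  refine h1.congr_of_eventuallyEq ?_
  filter_upwards [lt_mem_nhds hr] with s hs
  exact h.eq_integral s hs.le

/-- The quantity `rⁿ g(r) = ∫₀ʳ σ^{n-1} q B` is the flux `r^{n-1} B'(r)`. It grows where `q B ≥ 0`,
and its sign is that of `B'`. -/
lemma mean_mono (h : IsRadialSolution n q B) (hn : 1 ≤ n) {r₁ r₂ : ℝ} (h0 : 0 ≤ r₁) (hr : r₁ ≤ r₂)
    (hq : ∀ t ∈ Set.Ioo r₁ r₂, 0 ≤ q t * B t) :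
    r₁ ^ n * radialMean n (fun σ => q σ * B σ) r₁ ≤
      r₂ ^ n * radialMean n (fun σ => q σ * B σ) r₂ := by
  have hd := hasDerivAt_pow_mul_radialMean hn h.continuous_mul
  have : MonotoneOn (fun t => t ^ n * radialMean n (fun σ => q σ * B σ) t) (Set.Icc r₁ r₂) := by
    apply monotoneOn_of_deriv_nonneg (convex_Icc _ _)
    · exact fun t _ => (hd t).continuousAt.continuousWithinAt
    · exact fun t _ => (hd t).differentiableAt.differentiableWithinAt
    · intro t ht
      rw [interior_Icc] at ht
      rw [(hd t).deriv]
      exact mul_nonneg (pow_nonneg (h0.trans ht.1.le) _) (hq t ht)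
  exact this (Set.left_mem_Icc.2 hr) (Set.right_mem_Icc.2 hr) hr

/-- Where `q ≥ 0`, a solution that is positive and nondecreasing at one point stays positive. -/
lemma pos_of_nonneg (h : IsRadialSolution n q B) (hn : 1 ≤ n) {r₁ : ℝ} (h0 : 0 ≤ r₁)
    (hB : 0 < B r₁) (hP : 0 ≤ r₁ ^ n * radialMean n (fun σ => q σ * B σ) r₁)
    (hq : ∀ t, r₁ < t → 0 ≤ q t) {r : ℝ} (hr : r₁ ≤ r) : 0 < B r := by
  by_contra! hneg
  let K := Set.Icc r₁ r ∩ {t | B t ≤ 0}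
  have hK : IsCompact K := isCompact_Icc.inter_right (isClosed_le h.continuous continuous_const)
  -- Up to the first point `r₀` where `B ≤ 0` the flux stays nonnegative, so `B` cannot have
  -- decreased from `B r₁ > 0`.
  obtain ⟨r₀, ⟨⟨h1, h2⟩, h3⟩, hmin⟩ := hK.exists_isLeast ⟨r, ⟨hr, le_rfl⟩, hneg⟩
  have hpos (t : ℝ) (ht1 : r₁ ≤ t) (ht2 : t < r₀) : 0 < B t := by
    by_contra! hc
    exact absurd (hmin ⟨⟨ht1, ht2.le.trans h2⟩, hc⟩) (not_le.2 ht2)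
  have hmono : MonotoneOn B (Set.Icc r₁ r₀) := by
    apply monotoneOn_of_deriv_nonneg (convex_Icc _ _) h.continuous.continuousOn
    · intro t ht
      rw [interior_Icc] at ht
      exact (h.hasDerivAt (h0.trans_lt ht.1)).differentiableAt.differentiableWithinAt
    · intro t ht
      rw [interior_Icc] at ht
      have ht0 : 0 < t := h0.trans_lt ht.1
      rw [(h.hasDerivAt ht0).deriv]
      have := h.mean_mono hn h0 ht.1.le fun s hs =>
        mul_nonneg (hq s hs.1) (hpos s hs.1.le (hs.2.trans ht.2)).le
      exact mul_nonneg ht0.le (nonneg_of_mul_nonneg_right (hP.trans this) (pow_pos ht0 n))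
  have := hmono (Set.left_mem_Icc.2 h1) (Set.right_mem_Icc.2 h1) h1
  exact absurd (hB.trans_le this) (not_lt.2 h3)

/-- A nonnegative solution does not vanish. -/
lemma pos_of_forall_nonneg (h : IsRadialSolution n q B) (hn : 1 ≤ n) (hB : ∀ r, 0 ≤ r → 0 ≤ B r)
    {r₀ : ℝ} (hr₀ : 0 ≤ r₀) : 0 < B r₀ := by
  by_contra! hneg
  have hz : B r₀ = 0 := le_antisymm hneg (hB _ hr₀)
  have hpos : 0 < r₀ := by
    rcases hr₀.eq_or_lt with rfl | h1
    · rw [h.apply_zero] at hz; norm_num at hz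
    · exact h1
  set g := radialMean n (fun σ => q σ * B σ) with hg
  have hmin : IsLocalMin B r₀ := by
    filter_upwards [lt_mem_nhds hpos] with s hs
    rw [hz]; exact hB s hs.le
  have hgz : g r₀ = 0 := by
    have := hmin.hasDerivAt_eq_zero (h.hasDerivAt hpos)
    exact (mul_eq_zero.1 this).resolve_left hpos.ne'
  obtain ⟨Q, hQ⟩ := (isCompact_Icc (a := (0 : ℝ)) (b := r₀)).exists_bound_of_continuousOn
    h.continuous_coeff.continuousOn
  -- Backward uniqueness: an interior zero is a minimum, so `B` and `B' = t g` both vanish at `r₀`.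
  -- With the `C` below, `(B² + B'²) exp (C t)` is nondecreasing on `[ε, r₀]`: `1 + Q` absorbs the
  -- cross term `2 B B' (1 + q)`, and `2 (n - 1) / ε` absorbs the friction term `(n - 1) B' / t`.
  have key (ε : ℝ) (hε : 0 < ε) (hε' : ε < r₀) : B ε = 0 := by
    have hQ0 : 0 ≤ Q := (norm_nonneg _).trans (hQ r₀ ⟨hr₀, le_rfl⟩)
    have hn1 : (1 : ℝ) ≤ n := by exact_mod_cast hn
    set C := 1 + Q + 2 * (n - 1) / ε with hC
    have hd (t : ℝ) (ht : 0 < t) : HasDerivAt (fun t => (B t ^ 2 + (t * g t) ^ 2) * Real.exp (C * t))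
        ((2 * B t * (t * g t) + 2 * (t * g t) * (q t * B t - (n - 1) * g t)
          + C * (B t ^ 2 + (t * g t) ^ 2)) * Real.exp (C * t)) t := by
      have h1 := ((h.hasDerivAt ht).pow 2).add
        (((hasDerivAt_id t).mul (hasDerivAt_radialMean hn h.continuous_mul ht.ne')).pow 2)
      have h2 := ((hasDerivAt_id t).const_mul C).exp
      refine (h1.mul h2).congr_deriv ?_
      simp only [id, ← hg, Pi.pow_apply, Pi.add_apply, Pi.mul_apply]
      field_simp
      push_cast
      ring
    have hmono : MonotoneOn (fun t => (B t ^ 2 + (t * g t) ^ 2) * Real.exp (C * t))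
        (Set.Icc ε r₀) := by
      apply monotoneOn_of_deriv_nonneg (convex_Icc _ _)
      · exact fun t ht => (hd t (hε.trans_le ht.1)).continuousAt.continuousWithinAt
      · intro t ht
        rw [interior_Icc] at ht
        exact (hd t (hε.trans ht.1)).differentiableAt.differentiableWithinAt
      · intro t ht
        rw [interior_Icc] at ht
        have ht0 := hε.trans ht.1
        rw [(hd t ht0).deriv]
        refine mul_nonneg ?_ (Real.exp_nonneg _)
        have hqt := abs_le.1 (hQ t ⟨ht0.le, ht.2.le⟩)
        set D := t * g t with hD
        have hgD : g t = D / t := by rw [hD]; field_simp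
        have e1 : 2 * D * ((n - 1) * g t) ≤ 2 * (n - 1) / ε * D ^ 2 := by
          have : 2 * D * ((n - 1) * g t) = 2 * (n - 1) / t * D ^ 2 := by rw [hgD]; ring
          rw [this]
          have : 0 ≤ 2 * ((n : ℝ) - 1) := by linarith
          gcongr
          exact ht.1.le
        have e2 : 0 ≤ (1 + Q) * (B t ^ 2 + D ^ 2) + 2 * B t * D * (1 + q t) := by
          have a1 : 0 ≤ (1 + Q + (1 + q t)) * (B t + D) ^ 2 :=
            mul_nonneg (by linarith [hqt.1]) (sq_nonneg _)
          have a2 : 0 ≤ (1 + Q - (1 + q t)) * (B t - D) ^ 2 :=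
            mul_nonneg (by linarith [hqt.2]) (sq_nonneg _)
          nlinarith
        have e3 : 0 ≤ 2 * ((n : ℝ) - 1) / ε * B t ^ 2 :=
          mul_nonneg (div_nonneg (by linarith) hε.le) (sq_nonneg _)
        rw [hC]
        linarith
    have h1 := hmono (Set.left_mem_Icc.2 hε'.le) (Set.right_mem_Icc.2 hε'.le) hε'.le
    simp only [hz, hgz] at h1
    have h2 := Real.exp_pos (C * ε)
    have h3 : B ε ^ 2 ≤ 0 := by nlinarith [sq_nonneg (ε * g ε)]
    exact pow_eq_zero_iff (two_ne_zero) |>.1 (le_antisymm h3 (sq_nonneg _))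
  have hlim : Tendsto B (𝓝[>] 0) (𝓝 (B 0)) := h.continuous.continuousAt.tendsto.mono_left
    nhdsWithin_le_nhds
  have hlim' : Tendsto B (𝓝[>] 0) (𝓝 0) := by
    refine tendsto_const_nhds.congr' ?_
    filter_upwards [Ioo_mem_nhdsGT hpos] with s hs
    exact (key s hs.1 hs.2).symm
  have := tendsto_nhds_unique hlim hlim'
  rw [h.apply_zero] at this
  norm_num at this

lemma antitoneOn (h : IsRadialSolution n q B)
    (hg : ∀ r, 0 ≤ r → radialMean n (fun σ => q σ * B σ) r ≤ 0) :
    AntitoneOn B (Set.Ici 0) := by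
  apply antitoneOn_of_deriv_nonpos (convex_Ici _) h.continuous.continuousOn
  · intro t ht
    rw [interior_Ici] at ht
    exact (h.hasDerivAt ht).differentiableAt.differentiableWithinAt
  · intro t ht
    rw [interior_Ici] at ht
    rw [(h.hasDerivAt ht).deriv]
    exact mul_nonpos_of_nonneg_of_nonpos (le_of_lt ht) (hg t (le_of_lt ht))

end IsRadialSolution

/-! ### Shooting for the largest admissible parameter -/

/-- Shooting in the parameter `A`: at the largest `A` for which the radial solution of
`Δ b = (μ - A V) b` stays positive, this solution is decreasing. -/
theorem exists_decreasing_radialSolution {n : ℕ} (hn : 1 ≤ n) {μ : ℝ} (hμ : 0 < μ) {V : ℝ → ℝ}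
    (hVc : Continuous V) (hV0 : ∀ r, 0 < V r) {M : ℝ} (hVM : ∀ r, V r ≤ M)
    (hVa : AntitoneOn V (Set.Ici 0)) (hV : Tendsto V atTop (𝓝 0)) {A₁ : ℝ}
    (hA₁ : ∀ A B, 0 ≤ A → IsRadialSolution n (fun r => μ - A * V r) B →
      (∀ r, 0 ≤ r → 0 < B r) → A ≤ A₁) :
    ∃ A B, 0 ≤ A ∧ IsRadialSolution n (fun r => μ - A * V r) B ∧ (∀ r, 0 ≤ r → 0 < B r) ∧
      ∀ r, 0 ≤ r → radialMean n (fun σ => (μ - A * V σ) * B σ) r ≤ 0 := by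
  have hqc : Continuous (Function.uncurry fun A r => μ - A * V r) := by
    change Continuous fun z : ℝ × ℝ => μ - z.1 * V z.2
    fun_prop
  obtain ⟨B, hBc, hBeq⟩ := exists_radial_solution n (q := fun A r => μ - A * V r) hqc
    (Q := fun A => μ + |A| * M) (by fun_prop) (fun A r => by
      refine (abs_sub _ _).trans ?_
      rw [abs_of_pos hμ, abs_mul, abs_of_pos (hV0 r)]
      gcongr
      exact hVM r)
  have hB (A : ℝ) : IsRadialSolution n (fun r => μ - A * V r) (B A) :=
    { continuous_coeff := by fun_prop
      continuous := hBc.comp (by fun_prop : Continuous fun r => (A, r))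
      eq_integral := fun r hr => by rw [hBeq A r, abs_of_nonneg hr] }
  set S : Set ℝ := {A | 0 ≤ A ∧ ∀ r, 0 ≤ r → 0 < B A r} with hS
  have hS0 : (0 : ℝ) ∈ S := ⟨le_rfl, fun r hr => (hB 0).pos_of_nonneg hn le_rfl
    (by rw [(hB 0).apply_zero]; norm_num) (by simp [show n ≠ 0 by omega])
    (fun t _ => by simpa using hμ.le) hr⟩
  have hSb : BddAbove S := ⟨A₁, fun A hA => hA₁ A (B A) hA.1 (hB A) hA.2⟩
  set A := sSup S with hA
  have hA0 : 0 ≤ A := le_csSup hSb hS0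
  have hBnn (r : ℝ) (hr : 0 ≤ r) : 0 ≤ B A r := by
    have hcl : IsClosed {A | 0 ≤ B A r} := isClosed_le continuous_const
      (hBc.comp (by fun_prop : Continuous fun A => (A, r)))
    exact hcl.closure_subset_iff.2 (fun A' hA' => (hA'.2 r hr).le : S ⊆ {A | 0 ≤ B A r})
      (csSup_mem_closure ⟨0, hS0⟩ hSb)
  have hBpos (r : ℝ) (hr : 0 ≤ r) : 0 < B A r := (hB A).pos_of_forall_nonneg hn hBnn hr
  set g : ℝ → ℝ → ℝ := fun A' => radialMean n (fun σ => (μ - A' * V σ) * B A' σ) with hg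
  have hgA (r : ℝ) : Continuous fun A' => g A' r := by
    apply continuous_radialMean_param n (w := fun A' σ => (μ - A' * V σ) * B A' σ) _
      continuous_const
    exact hqc.mul hBc
  -- Using `A + 1` in place of `A` keeps the coefficient nonnegative beyond `R` for parameters
  -- slightly above `A` too.
  obtain ⟨R, hR0, hR⟩ : ∃ R : ℝ, 0 < R ∧ ∀ r, R ≤ r → (A + 1) * V r ≤ μ := by
    have : ∀ᶠ r in atTop, V r < μ / (A + 1) := hV.eventually_lt_const (by positivity)
    obtain ⟨R, hR⟩ := eventually_atTop.1 this
    refine ⟨max R 1, by positivity, fun r hr => ?_⟩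
    have := hR r ((le_max_left _ _).trans hr)
    rw [lt_div_iff₀ (by positivity)] at this
    linarith
  -- A positive flux at `r ≥ R`, and positivity on `[0, r]`, persist for some `A' > A`. Beyond `r`
  -- the coefficient is nonnegative, so `B A'` stays positive and `A' ∈ S`, against the choice of
  -- `A`.
  have hfar (r : ℝ) (hr : R ≤ r) : g A r ≤ 0 := by
    by_contra! hpos
    have h1 : ∀ᶠ A' in 𝓝 A, 0 < g A' r := (hgA r).continuousAt.eventually_const_lt hpos
    have h2 : ∀ᶠ A' in 𝓝 A, ∀ t ∈ Set.Icc 0 r, 0 < B A' t := by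
      apply isCompact_Icc.eventually_forall_of_forall_eventually
      intro t ht
      exact (hBc.continuousAt (x := (A, t))).eventually_const_lt (hBpos t ht.1)
    have h3 : ∀ᶠ A' in 𝓝[>] A, A' < A + 1 := by
      filter_upwards [Ioo_mem_nhdsGT (lt_add_one A)] with s hs using hs.2
    obtain ⟨A', ⟨⟨h1, h2⟩, h3⟩, h4⟩ :=
      (((h1.and h2).filter_mono nhdsWithin_le_nhds).and h3 |>.and self_mem_nhdsWithin).exists
    have h4 : A < A' := h4
    have hr0 : 0 < r := hR0.trans_le hr
    have : A' ∈ S := by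
      refine ⟨hA0.trans h4.le, fun t ht => ?_⟩
      rcases le_total t r with htr | htr
      · exact h2 t ⟨ht, htr⟩
      · refine (hB A').pos_of_nonneg hn hr0.le (h2 r ⟨hr0.le, le_rfl⟩) ?_ ?_ htr
        · exact mul_nonneg (pow_nonneg hr0.le _) h1.le
        · intro s hs
          have := hR s (hr.trans hs.le)
          have := mul_le_mul_of_nonneg_right h3.le (hV0 s).le
          simp only [sub_nonneg]
          linarith
    exact absurd (le_csSup hSb this) (not_le.2 h4)
  -- A positive flux at `r` requires a positive coefficient somewhere before `r`. As `V` decreases,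
  -- the coefficient stays positive afterwards, so the flux is still positive beyond `R`,
  -- contradicting `hfar`.
  have hpos' (r : ℝ) (hr : 0 < r) : g A r ≤ 0 := by
    by_contra! hpos
    obtain ⟨σ, hσ, hq⟩ : ∃ σ ∈ Set.Ioo 0 r, 0 < μ - A * V σ := by
      by_contra! hc
      have hP := pow_mul_radialMean hn (fun σ => (μ - A * V σ) * B A σ) r
      have : ∫ σ in (0 : ℝ)..r, σ ^ (n - 1) * ((μ - A * V σ) * B A σ) ≤ 0 := by
        rw [intervalIntegral.integral_of_le hr.le, integral_Ioc_eq_integral_Ioo]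
        refine setIntegral_nonpos measurableSet_Ioo fun σ hσ => ?_
        exact mul_nonpos_of_nonneg_of_nonpos (pow_nonneg hσ.1.le _)
          (mul_nonpos_of_nonpos_of_nonneg (hc σ hσ) (hBnn σ hσ.1.le))
      rw [← hP] at this
      have h2 : 0 < r ^ n * g A r := mul_pos (pow_pos hr n) hpos
      exact absurd this (not_le.2 h2)
    have hm := (hB A).mean_mono hn hr.le (le_max_left r R) (fun t ht => by
      refine mul_nonneg ?_ (hBnn t (hr.le.trans ht.1.le))
      have := hVa (Set.mem_Ici.2 hσ.1.le) (Set.mem_Ici.2 (hr.le.trans ht.1.le))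
        (hσ.2.le.trans ht.1.le)
      have := mul_le_mul_of_nonneg_left this hA0
      linarith)
    have h1 := hfar (max r R) (le_max_right _ _)
    have h2 : 0 < r ^ n * g A r := mul_pos (pow_pos hr n) hpos
    have h3 : (max r R) ^ n * g A (max r R) ≤ 0 := mul_nonpos_of_nonneg_of_nonpos
      (pow_nonneg (hr.le.trans (le_max_left _ _)) _) h1
    exact absurd (h2.trans_le (hm.trans h3)) (lt_irrefl _)
  refine ⟨A, B A, hA0, hB A, hBpos, fun r hr => ?_⟩
  rcases hr.eq_or_lt with rfl | hr
  · refine le_of_tendsto ((hB A).continuous_mean.continuousAt.tendsto.mono_left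
      (nhdsWithin_le_nhds (s := Set.Ioi 0))) ?_
    filter_upwards [self_mem_nhdsWithin] with s hs using hpos' s hs
  · exact hpos' r hr

/-! ### Radial calculus and the divergence theorem -/

lemma hasLineDerivAt_norm {F : Type*} [NormedAddCommGroup F] [InnerProductSpace ℝ F] {x : F}
    (hx : x ≠ 0) (v : F) : HasLineDerivAt ℝ (fun x : F => ‖x‖) (⟪x, v⟫_ℝ / ‖x‖) x v := by
  have hx' : ‖x‖ ≠ 0 := norm_ne_zero_iff.2 hx
  have h1 : HasDerivAt (fun t : ℝ => x + t • v) v 0 := by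
    simpa using ((hasDerivAt_id (0 : ℝ)).smul_const v).const_add x
  have h2 := h1.norm_sq.sqrt (by simpa using hx)
  simp only [Real.sqrt_sq (norm_nonneg _), zero_smul, add_zero] at h2
  refine h2.congr_deriv ?_
  field_simp

/-- The factor `t` makes differentiability of `c` unnecessary. This handles the radial field at the
origin, where its mean is only known to be continuous. -/
lemma hasDerivAt_zero_mul_of_continuousAt {c : ℝ → ℝ} (hc : ContinuousAt c 0) :
    HasDerivAt (fun t => c t * t) (c 0) 0 := by
  rw [hasDerivAt_iff_tendsto_slope_zero]
  refine (hc.tendsto.mono_left nhdsWithin_le_nhds).congr' ?_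
  filter_upwards [self_mem_nhdsWithin] with t ht
  have ht : t ≠ 0 := ht
  simp only [zero_add, mul_zero, sub_zero, smul_eq_mul]
  field_simp

section Radial

variable {n : ℕ}

lemma hasLineDerivAt_comp_norm_mul_coord {k : ℝ → ℝ} {k' : ℝ} {x : E n} (hx : x ≠ 0)
    (hk : HasDerivAt k k' ‖x‖) (i : Fin n) :
    HasLineDerivAt ℝ (fun x : E n => k ‖x‖ * x i) (k ‖x‖ + k' * (x i ^ 2 / ‖x‖)) x
      (EuclideanSpace.single i 1) := by
  have h1 := hasLineDerivAt_norm hx (EuclideanSpace.single i (1 : ℝ))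
  have h0 : HasDerivAt k k' ‖x + (0 : ℝ) • EuclideanSpace.single i (1 : ℝ)‖ := by simpa using hk
  have h2 := h0.comp (0 : ℝ) h1
  have h3 : HasDerivAt (fun t : ℝ => (x + t • EuclideanSpace.single i (1 : ℝ)) i) 1 0 := by
    simpa using (hasDerivAt_id (0 : ℝ)).const_add (x i)
  refine (h2.mul h3).congr_deriv ?_
  simp only [EuclideanSpace.inner_single_right, Function.comp, zero_smul, add_zero]
  simp
  ring

/-- The coordinates of the radial field `g(|x|) x`, with `g` the weighted mean of `w`. -/
lemma hasLineDerivAt_radial_field (hn : 1 ≤ n) {w : ℝ → ℝ} (hw : Continuous w) (x : E n)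
    (i : Fin n) :
    HasLineDerivAt ℝ (fun x : E n => radialMean n w ‖x‖ * x i)
      (radialMean n w ‖x‖ + (w ‖x‖ - n * radialMean n w ‖x‖) * (x i ^ 2 / ‖x‖ ^ 2)) x
      (EuclideanSpace.single i 1) := by
  by_cases hx : x = 0
  · subst hx
    have h := hasDerivAt_zero_mul_of_continuousAt (c := fun t => radialMean n w |t|)
      ((continuous_radialMean n hw).comp continuous_abs).continuousAt
    refine (h.congr_of_eventuallyEq ?_).congr_deriv ?_
    · refine Eventually.of_forall fun t => ?_
      simp [norm_smul]
    · simp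
  · have hx' : ‖x‖ ≠ 0 := norm_ne_zero_iff.2 hx
    convert hasLineDerivAt_comp_norm_mul_coord hx (hasDerivAt_radialMean hn hw hx') i using 1
    field_simp

lemma sum_sq_div_norm_sq {x : E n} (hx : x ≠ 0) : ∑ i, x i ^ 2 / ‖x‖ ^ 2 = 1 := by
  have hx' : ‖x‖ ≠ 0 := norm_ne_zero_iff.2 hx
  rw [← Finset.sum_div, EuclideanSpace.norm_sq_eq]
  simp only [Real.norm_eq_abs, sq_abs]
  apply div_self
  have := EuclideanSpace.norm_sq_eq x
  simp only [Real.norm_eq_abs, sq_abs] at this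
  rw [← this]; positivity

/-- The divergence theorem for the radial field `g(|x|) x`, whose divergence is `w(|x|)`. -/
lemma integral_mul_eq_neg_integral_radial_field (hn : 1 ≤ n) {w : ℝ → ℝ} (hw : Continuous w)
    {ψ : E n → ℝ} (hψ : ContDiff ℝ 1 ψ) (hψc : HasCompactSupport ψ) :
    ∫ x, ψ x * w ‖x‖ = -∫ x, radialMean n w ‖x‖ * fderiv ℝ ψ x x := by
  set g := radialMean n w with hg
  have hgc : Continuous g := continuous_radialMean n hw
  set d : Fin n → E n → ℝ := fun i x => g ‖x‖ + (w ‖x‖ - n * g ‖x‖) * (x i ^ 2 / ‖x‖ ^ 2) with hd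
  have hψ' : Continuous (fderiv ℝ ψ) := hψ.continuous_fderiv one_ne_zero
  have hψc' : HasCompactSupport (fderiv ℝ ψ) := hψc.fderiv ℝ
  -- The function `d i` may be discontinuous at the origin; its integrability against `ψ` rests on
  -- this bound.
  have hle (i : Fin n) (x : E n) : ‖x i ^ 2 / ‖x‖ ^ 2‖ ≤ 1 := by
    rw [Real.norm_eq_abs, abs_of_nonneg (by positivity)]
    apply div_le_one_of_le₀ _ (by positivity)
    rw [← sq_abs]
    exact pow_le_pow_left₀ (abs_nonneg _) (PiLp.norm_apply_le x i) 2
  have hi1 (i : Fin n) : Integrable fun x => ψ x * d i x := by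
    have h1 : Integrable fun x : E n => ψ x * g ‖x‖ :=
      Continuous.integrable_of_hasCompactSupport
        (hψ.continuous.mul (hgc.comp continuous_norm)) hψc.mul_right
    have h2 : Integrable fun x : E n => ψ x * (w ‖x‖ - n * g ‖x‖) :=
      Continuous.integrable_of_hasCompactSupport
        (hψ.continuous.mul ((hw.comp continuous_norm).sub
          (continuous_const.mul (hgc.comp continuous_norm)))) hψc.mul_right
    have h3 : Integrable fun x : E n => (x i ^ 2 / ‖x‖ ^ 2) * (ψ x * (w ‖x‖ - n * g ‖x‖)) := by
      apply h2.bdd_mul (c := 1) _ (ae_of_all _ (hle i))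
      have : Measurable fun x : E n => x i ^ 2 / ‖x‖ ^ 2 := by
        have : Measurable fun x : E n => x i := (by fun_prop : Continuous _).measurable
        fun_prop
      exact this.aestronglyMeasurable
    refine (h1.add h3).congr (ae_of_all _ fun x => ?_)
    simp only [hd, Pi.add_apply]
    ring
  have hi2 (i : Fin n) : Integrable fun x => fderiv ℝ ψ x (EuclideanSpace.single i 1) *
      (g ‖x‖ * x i) := by
    apply Continuous.integrable_of_hasCompactSupport (by fun_prop)
    apply HasCompactSupport.mul_right
    exact hψc'.comp_left (g := fun L : E n →L[ℝ] ℝ => L (EuclideanSpace.single i 1)) rfl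
  have hi3 (i : Fin n) : Integrable fun x => ψ x * (g ‖x‖ * x i) :=
    Continuous.integrable_of_hasCompactSupport (by have := hψ.continuous; fun_prop) hψc.mul_right
  have key (i : Fin n) : ∫ x, ψ x * d i x =
      -∫ x, fderiv ℝ ψ x (EuclideanSpace.single i 1) * (g ‖x‖ * x i) := by
    apply integral_bilinear_hasLineDerivAt_right_eq_neg_left_of_integrable
      (B := ContinuousLinearMap.mul ℝ ℝ) (v := EuclideanSpace.single i (1 : ℝ))
      (f := ψ) (g := fun x : E n => g ‖x‖ * x i)
    · exact hi2 i
    · exact hi1 i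
    · exact hi3 i
    · intro x _
      exact ((hψ.differentiable one_ne_zero) x).hasFDerivAt.hasLineDerivAt _
    · intro x _
      exact hasLineDerivAt_radial_field hn hw x i
  -- Off the origin the terms in `n g` cancel. At the origin the ratios are `0 / 0 = 0`, and the sum
  -- is `n g(0) = w(0)`.
  have e1 (x : E n) : ∑ i, d i x = w ‖x‖ := by
    simp only [hd, Finset.sum_add_distrib, ← Finset.mul_sum]
    by_cases hx : x = 0
    · subst hx
      simp [← radialMean_zero hn w, ← hg]
    · rw [sum_sq_div_norm_sq hx]
      simp
  have e2 (x : E n) : ∑ i, fderiv ℝ ψ x (EuclideanSpace.single i 1) * (g ‖x‖ * x i) =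
      g ‖x‖ * fderiv ℝ ψ x x := by
    have h := congrArg (fderiv ℝ ψ x) ((EuclideanSpace.basisFun (Fin n) ℝ).sum_repr x)
    rw [← h, map_sum, Finset.mul_sum]
    refine Finset.sum_congr rfl fun i _ => ?_
    simp only [EuclideanSpace.basisFun_repr, EuclideanSpace.basisFun_apply, map_smul, smul_eq_mul]
    ring
  calc ∫ x, ψ x * w ‖x‖ = ∫ x, ∑ i, ψ x * d i x := by
        simp_rw [← Finset.mul_sum, e1]
    _ = ∑ i, ∫ x, ψ x * d i x := integral_finsetSum _ fun i _ => hi1 i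
    _ = -∑ i, ∫ x, fderiv ℝ ψ x (EuclideanSpace.single i 1) * (g ‖x‖ * x i) := by
        rw [← Finset.sum_neg_distrib]
        exact Finset.sum_congr rfl fun i _ => key i
    _ = _ := by
        rw [← integral_finsetSum _ fun i _ => hi2 i]
        simp_rw [e2]

namespace IsRadialSolution

variable {q B : ℝ → ℝ}

lemma hasFDerivAt_comp_norm (h : IsRadialSolution n q B) (x : E n) :
    HasFDerivAt (fun x : E n => B ‖x‖)
      (radialMean n (fun σ => q σ * B σ) ‖x‖ • innerSL ℝ x) x := by
  set g := radialMean n (fun σ => q σ * B σ) with hg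
  have hc : Continuous fun t => t * g t := continuous_id.mul h.continuous_mean
  -- The integral formula replaces `B`, about which nothing is known at negative arguments, by a
  -- function differentiable on both sides of `0`.
  have hβ (r : ℝ) : HasDerivAt (fun r => 1 + ∫ t in (0 : ℝ)..r, t * g t) (r * g r) r :=
    (intervalIntegral.integral_hasDerivAt_right (hc.intervalIntegrable 0 r)
      (hc.stronglyMeasurableAtFilter _ _) hc.continuousAt).const_add 1
  have hB : (fun x : E n => B ‖x‖) = fun x => (fun r => 1 + ∫ t in (0 : ℝ)..r, t * g t) ‖x‖ := by
    ext x; exact h.eq_integral _ (norm_nonneg x)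
  rw [hB]
  by_cases hx : x = 0
  · subst hx
    have h0 := hβ 0
    rw [zero_mul, hasDerivAt_iff_isLittleO_nhds_zero] at h0
    rw [hasFDerivAt_iff_isLittleO_nhds_zero]
    have := h0.comp_tendsto (k := fun x : E n => ‖x‖) (l' := 𝓝 0)
      (by simpa using (continuous_norm (E := E n)).tendsto 0)
    simpa [Function.comp_def] using this.of_norm_right
  · have hx' : ‖x‖ ≠ 0 := norm_ne_zero_iff.2 hx
    have h1 : HasFDerivAt (fun x : E n => ‖x‖) (‖x‖⁻¹ • innerSL ℝ x) x := by
      have h2 := (hasStrictFDerivAt_norm_sq x).hasFDerivAt.sqrt (by positivity)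
      simp only [Real.sqrt_sq (norm_nonneg _)] at h2
      refine h2.congr_fderiv ?_
      ext v
      simp
      field_simp
    refine ((hβ ‖x‖).comp_hasFDerivAt x h1).congr_fderiv ?_
    ext v
    simp
    field_simp

lemma contDiff_comp_norm (h : IsRadialSolution n q B) :
    ContDiff ℝ 1 (fun x : E n => B ‖x‖) := by
  rw [contDiff_one_iff_hasFDerivAt]
  refine ⟨_, ?_, h.hasFDerivAt_comp_norm⟩
  have := h.continuous_mean
  fun_prop

end IsRadialSolution

end Radial

/-! ### Radially decreasing cutoffs -/

section Cutoff

lemma hasDerivAt_max_zero_sq (t : ℝ) :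
    HasDerivAt (fun t : ℝ => max 0 t ^ 2) (2 * max 0 t) t := by
  rcases lt_trichotomy t 0 with ht | rfl | ht
  · rw [max_eq_left ht.le, mul_zero]
    refine (hasDerivAt_const t (0 : ℝ)).congr_of_eventuallyEq ?_
    filter_upwards [gt_mem_nhds ht] with s hs
    simp [max_eq_left hs.le]
  · have h := hasDerivAt_zero_mul_of_continuousAt (c := fun t : ℝ => max 0 t)
      (by fun_prop : Continuous _).continuousAt
    refine (h.congr_of_eventuallyEq (Eventually.of_forall fun t => ?_)).congr_deriv (by simp)
    rcases le_total 0 t with h0 | h0 <;> simp [h0, sq]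
  · rw [max_eq_right ht.le]
    refine ((hasDerivAt_pow 2 t).congr_of_eventuallyEq ?_).congr_deriv (by simp)
    filter_upwards [lt_mem_nhds ht] with s hs
    simp [max_eq_right hs.le]

variable {n : ℕ}

/-- A radially decreasing `C¹` cutoff function supported in the ball of radius `R`. -/
noncomputable def cutoff (R : ℝ) (x : E n) : ℝ := max 0 (1 - ‖x‖ ^ 2 / R ^ 2) ^ 2

lemma hasFDerivAt_cutoff (R : ℝ) (x : E n) :
    HasFDerivAt (cutoff (n := n) R)
      (-(4 * max 0 (1 - ‖x‖ ^ 2 / R ^ 2) / R ^ 2) • innerSL ℝ x) x := by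
  have h1 : HasFDerivAt (fun x : E n => 1 - ‖x‖ ^ 2 / R ^ 2)
      (-((2 / R ^ 2) • innerSL ℝ x)) x := by
    have h2 := ((hasStrictFDerivAt_norm_sq x).hasFDerivAt.mul_const (R ^ 2)⁻¹).const_sub 1
    refine h2.congr_fderiv ?_
    ext v
    simp
    ring
  refine ((hasDerivAt_max_zero_sq (1 - ‖x‖ ^ 2 / R ^ 2)).comp_hasFDerivAt x h1).congr_fderiv ?_
  ext v
  simp
  ring

lemma contDiff_cutoff (R : ℝ) : ContDiff ℝ 1 (cutoff (n := n) R) := by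
  rw [contDiff_one_iff_hasFDerivAt]
  exact ⟨_, by fun_prop, hasFDerivAt_cutoff R⟩

lemma cutoff_nonneg (R : ℝ) (x : E n) : 0 ≤ cutoff R x := sq_nonneg _

lemma cutoff_le_one (R : ℝ) (x : E n) : cutoff R x ≤ 1 := by
  apply pow_le_one₀ (le_max_left _ _)
  have : 0 ≤ ‖x‖ ^ 2 / R ^ 2 := by positivity
  exact max_le zero_le_one (by linarith)

lemma hasCompactSupport_cutoff {R : ℝ} (hR : 0 < R) : HasCompactSupport (cutoff (n := n) R) := by
  apply HasCompactSupport.intro (isCompact_closedBall (0 : E n) R)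
  intro x hx
  rw [mem_closedBall_zero_iff, not_le] at hx
  have : 1 ≤ ‖x‖ ^ 2 / R ^ 2 := by
    rw [one_le_div (by positivity)]
    exact pow_le_pow_left₀ hR.le hx.le 2
  simp [cutoff, max_eq_left (sub_nonpos.2 this)]

lemma fderiv_cutoff_apply_self_nonpos (R : ℝ) (x : E n) : fderiv ℝ (cutoff R) x x ≤ 0 := by
  rw [(hasFDerivAt_cutoff R x).fderiv]
  simp only [smul_apply, innerSL_apply_apply, smul_eq_mul,
    real_inner_self_eq_norm_sq]
  have : 0 ≤ 4 * max 0 (1 - ‖x‖ ^ 2 / R ^ 2) / R ^ 2 * ‖x‖ ^ 2 := by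
    have := le_max_left 0 (1 - ‖x‖ ^ 2 / R ^ 2)
    positivity
  linarith

lemma norm_fderiv_cutoff_le {R : ℝ} (hR : 0 < R) (x : E n) :
    ‖fderiv ℝ (cutoff R) x‖ ≤ 4 / R := by
  have h0 := le_max_left 0 (1 - ‖x‖ ^ 2 / R ^ 2)
  rw [(hasFDerivAt_cutoff R x).fderiv, norm_smul, innerSL_apply_norm, norm_neg,
    Real.norm_eq_abs, abs_of_nonneg (by positivity)]
  rcases le_total ‖x‖ R with hx | hx
  · have h1 : max 0 (1 - ‖x‖ ^ 2 / R ^ 2) ≤ 1 := by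
      have : 0 ≤ ‖x‖ ^ 2 / R ^ 2 := by positivity
      exact max_le zero_le_one (by linarith)
    calc 4 * max 0 (1 - ‖x‖ ^ 2 / R ^ 2) / R ^ 2 * ‖x‖ ≤ 4 * 1 / R ^ 2 * R := by gcongr
      _ = 4 / R := by field_simp
  · have : 1 ≤ ‖x‖ ^ 2 / R ^ 2 := by
      rw [one_le_div (by positivity)]
      exact pow_le_pow_left₀ hR.le hx 2
    rw [max_eq_left (sub_nonpos.2 this)]
    simp only [mul_zero, zero_div, zero_mul]
    positivity

lemma tendsto_cutoff (x : E n) : Tendsto (fun k : ℕ => cutoff ((k : ℝ) + 1) x) atTop (𝓝 1) := by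
  have h1 : Tendsto (fun k : ℕ => ‖x‖ ^ 2 / ((k : ℝ) + 1) ^ 2) atTop (𝓝 0) := by
    apply Tendsto.const_div_atTop
    exact (tendsto_pow_atTop two_ne_zero).comp
      (tendsto_atTop_add_const_right _ _ tendsto_natCast_atTop_atTop)
  have h2 : Continuous fun t : ℝ => max 0 (1 - t) ^ 2 := by fun_prop
  have := (h2.tendsto 0).comp h1
  simpa [Function.comp_def, cutoff] using this

lemma quarter_le_cutoff {R : ℝ} (hR : 0 < R) {x : E n} (hx : ‖x‖ ≤ R / 2) :
    1 / 4 ≤ cutoff R x := by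
  have h1 : ‖x‖ ^ 2 / R ^ 2 ≤ 1 / 4 := by
    rw [div_le_iff₀ (by positivity)]
    nlinarith [norm_nonneg x]
  have h2 : 3 / 4 ≤ max 0 (1 - ‖x‖ ^ 2 / R ^ 2) := le_max_of_le_right (by linarith)
  have := pow_le_pow_left₀ (by norm_num) h2 2
  unfold cutoff
  linarith

lemma integral_tendsto_cutoff {J : E n → ℝ} (hJ : Integrable J) :
    Tendsto (fun k : ℕ => ∫ x, cutoff ((k : ℝ) + 1) x * J x) atTop (𝓝 (∫ x, J x)) := by
  apply tendsto_integral_of_dominated_convergence (fun x => ‖J x‖)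
  · exact fun k => (contDiff_cutoff _).continuous.aestronglyMeasurable.mul hJ.aestronglyMeasurable
  · exact hJ.norm
  · refine fun k => ae_of_all _ fun x => ?_
    rw [norm_mul, Real.norm_eq_abs, abs_of_nonneg (cutoff_nonneg _ _)]
    exact mul_le_of_le_one_left (norm_nonneg _) (cutoff_le_one _ _)
  · refine ae_of_all _ fun x => ?_
    simpa using (tendsto_cutoff x).mul_const (J x)

end Cutoff

/-! ### Picone's inequality and finite energy -/

namespace IsRadialSolution

variable {n : ℕ} {q B : ℝ → ℝ}

/-- Picone's inequality for a positive radial solution. -/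
theorem integral_picone_nonneg (h : IsRadialSolution n q B) (hn : 1 ≤ n)
    (hB : ∀ r, 0 ≤ r → 0 < B r) {φ : E n → ℝ} (hφ : ContDiff ℝ 1 φ) (hφc : HasCompactSupport φ) :
    0 ≤ ∫ x, (‖fderiv ℝ φ x‖ ^ 2 + q ‖x‖ * φ x ^ 2) := by
  set g := radialMean n (fun σ => q σ * B σ) with hg
  have hgc : Continuous g := h.continuous_mean
  have hqc := h.continuous_coeff
  have hBp (x : E n) : B ‖x‖ ≠ 0 := (hB _ (norm_nonneg x)).ne'
  have hb := h.contDiff_comp_norm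
  -- Testing `Δb = q b` against `φ² / b` gives `∫ (q φ² + ∇b · ∇(φ²/b)) = 0`, while `|∇φ|² - ∇b ·
  -- ∇(φ²/b) = |∇φ - (φ/b) ∇b|²`.
  set ψ : E n → ℝ := fun x => φ x ^ 2 / B ‖x‖ with hψd
  have hψ : ContDiff ℝ 1 ψ := (hφ.pow 2).div hb hBp
  have hψc : HasCompactSupport ψ := by
    have : HasCompactSupport fun x => φ x * (φ x / B ‖x‖) := hφc.mul_right
    refine this.mono fun x hx => ?_
    simp only [Function.mem_support, hψd] at hx ⊢
    convert hx using 1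
    ring
  have hφ' : Continuous (fderiv ℝ φ) := hφ.continuous_fderiv one_ne_zero
  have hψ' : Continuous (fderiv ℝ ψ) := hψ.continuous_fderiv one_ne_zero
  have hψc' : HasCompactSupport (fderiv ℝ ψ) := hψc.fderiv ℝ
  have hφc' : HasCompactSupport (fderiv ℝ φ) := hφc.fderiv ℝ
  have hi : Integrable fun x : E n => g ‖x‖ * fderiv ℝ ψ x x := by
    apply Continuous.integrable_of_hasCompactSupport (by fun_prop)
    apply HasCompactSupport.mul_left
    refine hψc'.mono' fun x hx => subset_tsupport _ ?_
    simp only [Function.mem_support] at hx ⊢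
    rintro h0
    simp [h0] at hx
  have hi1 : Integrable fun x : E n => ψ x * (q ‖x‖ * B ‖x‖) :=
    Continuous.integrable_of_hasCompactSupport
      (hψ.continuous.mul ((hqc.comp continuous_norm).mul hb.continuous)) hψc.mul_right
  have hi2 : Integrable fun x : E n => ‖fderiv ℝ φ x‖ ^ 2 + q ‖x‖ * φ x ^ 2 := by
    have := hφ.continuous
    refine Integrable.add ?_ ?_
    · refine Continuous.integrable_of_hasCompactSupport (by fun_prop) ?_
      exact hφc'.comp_left (g := fun L : E n →L[ℝ] ℝ => ‖L‖ ^ 2) (by simp)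
    · refine Continuous.integrable_of_hasCompactSupport (by fun_prop) ?_
      exact HasCompactSupport.mul_left (hφc.comp_left (g := fun t : ℝ => t ^ 2) (by simp))
  have hdiv := integral_mul_eq_neg_integral_radial_field hn h.continuous_mul hψ hψc
  have hzero : ∫ x : E n, (ψ x * (q ‖x‖ * B ‖x‖) + g ‖x‖ * fderiv ℝ ψ x x) = 0 := by
    rw [integral_add hi1 hi, hdiv]; ring
  rw [← hzero]
  refine integral_mono (hi1.add hi) hi2 fun x => ?_
  have hBx := hBp x
  have hdψ : HasFDerivAt ψ _ x :=
    (((hφ.differentiable one_ne_zero x).hasFDerivAt.pow 2).mul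
      ((hasDerivAt_inv hBx).comp_hasFDerivAt x (h.hasFDerivAt_comp_norm x)))
  rw [hdψ.fderiv]
  simp only [add_apply, smul_apply, smul_eq_mul,
    innerSL_apply_apply, real_inner_self_eq_norm_sq, ← hg, hψd]
  have h1 : ‖fderiv ℝ φ x x‖ ≤ ‖fderiv ℝ φ x‖ * ‖x‖ := ContinuousLinearMap.le_opNorm _ _
  set D := fderiv ℝ φ x x
  -- Here `m x = (φ/b) ∇b`, so the next bound is `|∇φ - m x|² ≥ 0` expanded.
  set m := φ x * g ‖x‖ / B ‖x‖ with hm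
  have h2 : 2 * m * D ≤ ‖fderiv ℝ φ x‖ ^ 2 + m ^ 2 * ‖x‖ ^ 2 := by
    have a1 : 2 * m * D ≤ 2 * |m| * (‖fderiv ℝ φ x‖ * ‖x‖) := by
      calc 2 * m * D ≤ |2 * m * D| := le_abs_self _
        _ = 2 * |m| * |D| := by rw [abs_mul, abs_mul, abs_two]
        _ ≤ _ := by gcongr; exact h1
    nlinarith [sq_nonneg (‖fderiv ℝ φ x‖ - |m| * ‖x‖), sq_abs m]
  have h3 : φ x ^ 2 / B ‖x‖ * (q ‖x‖ * B ‖x‖) = q ‖x‖ * φ x ^ 2 := by field_simp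
  rw [h3]
  have h4 : ∀ z : ℝ, z = 2 * m * D - m ^ 2 * ‖x‖ ^ 2 →
      q ‖x‖ * φ x ^ 2 + z ≤ ‖fderiv ℝ φ x‖ ^ 2 + q ‖x‖ * φ x ^ 2 := by
    intro z hz; rw [hz]; linarith
  apply h4
  simp [hm]
  field_simp
  ring

/-- Testing the equation against `χ b`, with `χ` the cutoff, leaves `-∫ b ∇b · ∇χ`. This is
nonpositive because `b` and `χ` both decrease radially, so no decay of `b` is needed. -/
lemma integral_cutoff_mul_energy_nonpos (h : IsRadialSolution n q B) (hn : 1 ≤ n)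
    (hB : ∀ r, 0 ≤ r → 0 < B r) (hg : ∀ r, 0 ≤ r → radialMean n (fun σ => q σ * B σ) r ≤ 0)
    {R : ℝ} (hR : 0 < R) :
    ∫ x : E n, cutoff R x *
      (radialMean n (fun σ => q σ * B σ) ‖x‖ ^ 2 * ‖x‖ ^ 2 + q ‖x‖ * B ‖x‖ ^ 2) ≤ 0 := by
  set g := radialMean n (fun σ => q σ * B σ) with hgd
  have hgc : Continuous g := h.continuous_mean
  have hqc := h.continuous_coeff
  have hb := h.contDiff_comp_norm (n := n)
  have hBc := h.continuous
  have hχ := contDiff_cutoff (n := n) R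
  have hχc := hasCompactSupport_cutoff (n := n) hR
  set ψ : E n → ℝ := fun x => cutoff R x * B ‖x‖ with hψd
  have hψ : ContDiff ℝ 1 ψ := hχ.mul hb
  have hψc : HasCompactSupport ψ := hχc.mul_right
  have hχ0 := hχ.continuous
  have hχ' : Continuous (fderiv ℝ (cutoff (n := n) R)) := hχ.continuous_fderiv one_ne_zero
  have hχc' : HasCompactSupport (fderiv ℝ (cutoff (n := n) R)) := hχc.fderiv ℝ
  have hdiv := integral_mul_eq_neg_integral_radial_field hn h.continuous_mul hψ hψc
  have hdψ (x : E n) : fderiv ℝ ψ x x =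
      cutoff R x * (g ‖x‖ * ‖x‖ ^ 2) + B ‖x‖ * fderiv ℝ (cutoff R) x x := by
    have : HasFDerivAt ψ _ x :=
      (hχ.differentiable one_ne_zero x).hasFDerivAt.mul (h.hasFDerivAt_comp_norm x)
    rw [this.fderiv]
    simp only [add_apply, smul_apply, smul_eq_mul,
      innerSL_apply_apply, real_inner_self_eq_norm_sq, ← hgd]
  have hi1 : Integrable fun x : E n => cutoff R x * (g ‖x‖ ^ 2 * ‖x‖ ^ 2) :=
    Continuous.integrable_of_hasCompactSupport (by fun_prop) hχc.mul_right
  have hi2 : Integrable fun x : E n => g ‖x‖ * (B ‖x‖ * fderiv ℝ (cutoff R) x x) := by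
    apply Continuous.integrable_of_hasCompactSupport (by fun_prop)
    apply HasCompactSupport.mul_left
    apply HasCompactSupport.mul_left
    refine hχc'.mono' fun x hx => subset_tsupport _ ?_
    simp only [Function.mem_support] at hx ⊢
    rintro h0
    simp [h0] at hx
  have hi3 : Integrable fun x : E n => cutoff R x * (q ‖x‖ * B ‖x‖ ^ 2) :=
    Continuous.integrable_of_hasCompactSupport (by fun_prop) hχc.mul_right
  have e1 : ∫ x : E n, cutoff R x * (q ‖x‖ * B ‖x‖ ^ 2) =
      -((∫ x : E n, cutoff R x * (g ‖x‖ ^ 2 * ‖x‖ ^ 2)) +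
        ∫ x : E n, g ‖x‖ * (B ‖x‖ * fderiv ℝ (cutoff R) x x)) := by
    rw [← integral_add hi1 hi2]
    refine (Eq.trans ?_ hdiv).trans ?_
    · refine integral_congr_ae (ae_of_all _ fun x => ?_)
      simp only [hψd]; ring
    · congr 1
      refine integral_congr_ae (ae_of_all _ fun x => ?_)
      simp only [hdψ, ← hgd]; ring
  have e2 : 0 ≤ ∫ x : E n, g ‖x‖ * (B ‖x‖ * fderiv ℝ (cutoff R) x x) := by
    refine integral_nonneg fun x => ?_
    exact mul_nonneg_of_nonpos_of_nonpos (hg _ (norm_nonneg x))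
      (mul_nonpos_of_nonneg_of_nonpos (hB _ (norm_nonneg x)).le
        (fderiv_cutoff_apply_self_nonpos R x))
  simp_rw [mul_add]
  rw [integral_add hi1 hi3, e1]
  linarith

/-- A positive decreasing radial solution lies in `L²₁`. -/
theorem integrable_energy (h : IsRadialSolution n q B) (hn : 1 ≤ n)
    (hB : ∀ r, 0 ≤ r → 0 < B r) (hg : ∀ r, 0 ≤ r → radialMean n (fun σ => q σ * B σ) r ≤ 0)
    {c R₀ : ℝ} (hc : 0 < c) (hq : ∀ r, R₀ ≤ r → c ≤ q r) :
    Integrable (fun x : E n => B ‖x‖ ^ 2) ∧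
    Integrable (fun x : E n => radialMean n (fun σ => q σ * B σ) ‖x‖ ^ 2 * ‖x‖ ^ 2) := by
  have hcut {R : ℝ} (hR : 0 < R) := h.integral_cutoff_mul_energy_nonpos hn hB hg hR
  set g := radialMean n (fun σ => q σ * B σ) with hgd
  have hgc : Continuous g := h.continuous_mean
  have hqc := h.continuous_coeff
  have hBc := h.continuous
  obtain ⟨C, hC⟩ := (isCompact_Icc (a := (0 : ℝ)) (b := R₀)).exists_bound_of_continuousOn
    h.continuous_coeff.continuousOn
  -- Inside the ball only `q ≥ -C` is known; adding `(c + C) B²` there restores the lower bound `c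
  -- B²`, uniformly in the cutoff radius.
  set K : ℝ := ∫ x in Metric.closedBall (0 : E n) R₀, (c + C) * B ‖x‖ ^ 2 with hK
  have hKi : IntegrableOn (fun x : E n => (c + C) * B ‖x‖ ^ 2) (Metric.closedBall (0 : E n) R₀) :=
    (by fun_prop : Continuous _).continuousOn.integrableOn_compact (isCompact_closedBall _ _)
  have hKi' := hKi.integrable_indicator measurableSet_closedBall
  set J : E n → ℝ := fun x => g ‖x‖ ^ 2 * ‖x‖ ^ 2 + c * B ‖x‖ ^ 2 with hJ
  have hJc : Continuous J := by fun_prop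
  have hJ0 (x : E n) : 0 ≤ J x := by positivity
  have hle (x : E n) : J x ≤ (g ‖x‖ ^ 2 * ‖x‖ ^ 2 + q ‖x‖ * B ‖x‖ ^ 2) +
      (Metric.closedBall (0 : E n) R₀).indicator (fun x : E n => (c + C) * B ‖x‖ ^ 2) x := by
    have hB2 := sq_nonneg (B ‖x‖)
    by_cases hx : x ∈ Metric.closedBall (0 : E n) R₀
    · rw [Set.indicator_of_mem hx]
      have := (abs_le.1 (hC ‖x‖ ⟨norm_nonneg x, by simpa using hx⟩)).1
      simp only [hJ]
      nlinarith
    · rw [Set.indicator_of_notMem hx]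
      have := hq ‖x‖ (by simpa using (not_le.1 fun h => hx (by simpa using h)).le)
      simp only [hJ]
      nlinarith
  have hJK {R : ℝ} (hR : 0 < R) : ∫ x : E n, cutoff R x * J x ≤ K := by
    have hχc := hasCompactSupport_cutoff (n := n) hR
    have hχ0 := (contDiff_cutoff (n := n) R).continuous
    have i1 : Integrable fun x : E n => cutoff R x * J x :=
      Continuous.integrable_of_hasCompactSupport (by fun_prop) hχc.mul_right
    have i2 : Integrable fun x : E n => cutoff R x *
        (g ‖x‖ ^ 2 * ‖x‖ ^ 2 + q ‖x‖ * B ‖x‖ ^ 2) :=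
      Continuous.integrable_of_hasCompactSupport (by fun_prop) hχc.mul_right
    calc ∫ x : E n, cutoff R x * J x ≤ ∫ x : E n, (cutoff R x *
          (g ‖x‖ ^ 2 * ‖x‖ ^ 2 + q ‖x‖ * B ‖x‖ ^ 2) + (Metric.closedBall (0 : E n) R₀).indicator
            (fun x : E n => (c + C) * B ‖x‖ ^ 2) x) := by
          refine integral_mono i1 (i2.add hKi') fun x => ?_
          have h1 := mul_le_mul_of_nonneg_left (hle x) (cutoff_nonneg R x)
          have h2 : 0 ≤ (Metric.closedBall (0 : E n) R₀).indicator
              (fun x : E n => (c + C) * B ‖x‖ ^ 2) x := by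
            refine Set.indicator_nonneg (fun y hy => ?_) x
            have := (norm_nonneg _).trans (hC ‖y‖ ⟨norm_nonneg y, by simpa using hy⟩)
            positivity
          have h3 := mul_le_of_le_one_left h2 (cutoff_le_one R x)
          rw [mul_add] at h1
          simp only
          linarith
      _ ≤ K := by
          rw [integral_add i2 hKi', integral_indicator measurableSet_closedBall]
          linarith [hcut hR]
  have hJi : Integrable J := by
    have hcov : AECover (volume : Measure (E n)) atTop
        fun k : ℕ => Metric.closedBall (0 : E n) (((k : ℝ) + 1) / 2) :=
      aecover_closedBall ((tendsto_atTop_add_const_right _ _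
        tendsto_natCast_atTop_atTop).atTop_div_const two_pos)
    -- The factor `4` appears because the cutoff is at least `1/4` on the ball of half its radius.
    refine hcov.integrable_of_integral_bounded_of_nonneg_ae (4 * K)
      (fun k => hJc.continuousOn.integrableOn_compact (isCompact_closedBall _ _))
      (ae_of_all _ hJ0) (Eventually.of_forall fun k => ?_)
    have hk : (0 : ℝ) < (k : ℝ) + 1 := by positivity
    have hχc := hasCompactSupport_cutoff (n := n) hk
    have hχ0 := (contDiff_cutoff (n := n) ((k : ℝ) + 1)).continuous
    have i1 : Integrable fun x : E n => 4 * (cutoff ((k : ℝ) + 1) x * J x) :=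
      (Continuous.integrable_of_hasCompactSupport (by fun_prop) hχc.mul_right).const_mul 4
    calc ∫ x in Metric.closedBall (0 : E n) (((k : ℝ) + 1) / 2), J x
        ≤ ∫ x in Metric.closedBall (0 : E n) (((k : ℝ) + 1) / 2),
            4 * (cutoff ((k : ℝ) + 1) x * J x) := by
          refine setIntegral_mono_on (hJc.continuousOn.integrableOn_compact
            (isCompact_closedBall _ _)) i1.integrableOn measurableSet_closedBall fun x hx => ?_
          have := quarter_le_cutoff hk (by simpa using hx : ‖x‖ ≤ ((k : ℝ) + 1) / 2)
          nlinarith [hJ0 x]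
      _ ≤ ∫ x : E n, 4 * (cutoff ((k : ℝ) + 1) x * J x) :=
          setIntegral_le_integral i1 (ae_of_all _ fun x =>
            mul_nonneg (by norm_num) (mul_nonneg (cutoff_nonneg _ _) (hJ0 x)))
      _ ≤ 4 * K := by
          rw [integral_const_mul]
          linarith [hJK hk]
  constructor
  · refine (hJi.const_mul c⁻¹).mono' (by fun_prop : Continuous _).aestronglyMeasurable
      (ae_of_all _ fun x => ?_)
    rw [Real.norm_eq_abs, abs_of_nonneg (sq_nonneg _), inv_mul_eq_div, le_div_iff₀ hc]
    simp only [hJ]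
    nlinarith [mul_nonneg (sq_nonneg (g ‖x‖)) (sq_nonneg ‖x‖)]
  · refine hJi.mono' (by fun_prop : Continuous _).aestronglyMeasurable (ae_of_all _ fun x => ?_)
    rw [Real.norm_eq_abs, abs_of_nonneg (by positivity)]
    simp only [hJ]
    nlinarith [mul_nonneg hc.le (sq_nonneg (B ‖x‖))]

theorem integral_energy_nonpos (h : IsRadialSolution n q B) (hn : 1 ≤ n)
    (hB : ∀ r, 0 ≤ r → 0 < B r) (hg : ∀ r, 0 ≤ r → radialMean n (fun σ => q σ * B σ) r ≤ 0)
    (hi : Integrable fun x : E n => radialMean n (fun σ => q σ * B σ) ‖x‖ ^ 2 * ‖x‖ ^ 2 +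
      q ‖x‖ * B ‖x‖ ^ 2) :
    ∫ x : E n, (radialMean n (fun σ => q σ * B σ) ‖x‖ ^ 2 * ‖x‖ ^ 2 + q ‖x‖ * B ‖x‖ ^ 2) ≤ 0 :=
  le_of_tendsto (integral_tendsto_cutoff hi) (Eventually.of_forall fun k =>
    h.integral_cutoff_mul_energy_nonpos hn hB hg (by positivity))

lemma isSobolev (h : IsRadialSolution n q B)
    (h1 : Integrable fun x : E n => B ‖x‖ ^ 2)
    (h2 : Integrable fun x : E n => radialMean n (fun σ => q σ * B σ) ‖x‖ ^ 2 * ‖x‖ ^ 2) :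
    IsSobolev (fun x : E n => B ‖x‖) fun x => radialMean n (fun σ => q σ * B σ) ‖x‖ • x := by
  have hgc := h.continuous_mean
  have hBc := h.continuous
  constructor
  · rw [memLp_two_iff_integrable_sq (by fun_prop : Continuous _).aestronglyMeasurable]
    exact h1
  · rw [memLp_two_iff_integrable_sq_norm (by fun_prop : Continuous _).aestronglyMeasurable]
    refine h2.congr (ae_of_all _ fun x => ?_)
    simp only [norm_smul, mul_pow, Real.norm_eq_abs, sq_abs]
  · intro φ hφ hφc v
    have hb := h.contDiff_comp_norm (n := n)
    have hφ' : Continuous (fderiv ℝ φ) := hφ.continuous_fderiv (by simp)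
    have hd (x : E n) : fderiv ℝ (fun x : E n => B ‖x‖) x v =
        ⟪radialMean n (fun σ => q σ * B σ) ‖x‖ • x, v⟫_ℝ := by
      rw [(h.hasFDerivAt_comp_norm x).fderiv, inner_smul_left]
      simp
    rw [integral_mul_fderiv_eq_neg_fderiv_mul_of_integrable]
    · simp_rw [hd]
    · simp_rw [hd]
      have := hφ.continuous
      exact Continuous.integrable_of_hasCompactSupport (by fun_prop) hφc.mul_left
    · refine Continuous.integrable_of_hasCompactSupport (by fun_prop) ?_
      apply HasCompactSupport.mul_left
      exact (hφc.fderiv ℝ).comp_left (g := fun L : E n →L[ℝ] ℝ => L v) rfl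
    · have := hφ.continuous
      exact Continuous.integrable_of_hasCompactSupport (by fun_prop) hφc.mul_left
    · exact fun x _ => hb.differentiable one_ne_zero x
    · exact fun x _ => hφ.differentiable (by simp) x

end IsRadialSolution

/-! ### Mollification and extension of forms to `L²₁` -/

/-- A form of Fatou's lemma for real integrals. -/
lemma integral_le_of_ae_tendsto {α : Type*} [MeasurableSpace α] {ν : Measure α} {F : ℕ → α → ℝ}
    {f : α → ℝ} {C : ℝ} (hF : ∀ k, Integrable (F k) ν) (hF0 : ∀ k x, 0 ≤ F k x)
    (hC : ∀ k, ∫ x, F k x ∂ν ≤ C) (hf : AEStronglyMeasurable f ν)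
    (hlim : ∀ᵐ x ∂ν, Tendsto (fun k => F k x) atTop (𝓝 (f x))) : ∫ x, f x ∂ν ≤ C := by
  have hC0 : 0 ≤ C := (integral_nonneg (hF0 0)).trans (hC 0)
  have hf0 : 0 ≤ᵐ[ν] f := by
    filter_upwards [hlim] with x hx
    exact ge_of_tendsto hx (Eventually.of_forall fun k => hF0 k x)
  rw [integral_eq_lintegral_of_nonneg_ae hf0 hf]
  apply ENNReal.toReal_le_of_le_ofReal hC0
  calc ∫⁻ x, ENNReal.ofReal (f x) ∂ν
      = ∫⁻ x, liminf (fun k => ENNReal.ofReal (F k x)) atTop ∂ν := by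
        refine lintegral_congr_ae ?_
        filter_upwards [hlim] with x hx
        exact ((ENNReal.continuous_ofReal.tendsto _).comp hx).liminf_eq.symm
    _ ≤ liminf (fun k => ∫⁻ x, ENNReal.ofReal (F k x) ∂ν) atTop :=
        lintegral_liminf_le' fun k => (hF k).aestronglyMeasurable.aemeasurable.ennreal_ofReal
    _ ≤ ENNReal.ofReal C := by
        refine liminf_le_of_frequently_le' (Frequently.of_forall fun k => ?_)
        rw [← ofReal_integral_eq_lintegral_ofReal (hF k) (ae_of_all _ (hF0 k))]
        exact ENNReal.ofReal_le_ofReal (hC k)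

section Mollification

open scoped Convolution

variable {n : ℕ}

/-- The mollification of `u` with the normed bump function of `ρ`. -/
noncomputable def mollify (ρ : ContDiffBump (0 : E n)) (u : E n → ℝ) : E n → ℝ :=
  ρ.normed volume ⋆[ContinuousLinearMap.lsmul ℝ ℝ, volume] u

variable (ρ : ContDiffBump (0 : E n)) {u : E n → ℝ}

lemma mollify_apply (x : E n) : mollify ρ u x = ∫ t, ρ.normed volume t * u (x - t) := rfl

lemma mollify_apply_swap (x : E n) : mollify ρ u x = ∫ y, ρ.normed volume (x - y) * u y := by
  rw [mollify, convolution_eq_swap]; rfl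

lemma integrable_mollify_integrand (hu : LocallyIntegrable u) (x : E n) :
    Integrable fun t => ρ.normed volume t * u (x - t) :=
  ρ.hasCompactSupport_normed.convolutionExists_left (ContinuousLinearMap.lsmul ℝ ℝ)
    ρ.continuous_normed hu x

lemma contDiff_mollify (hu : LocallyIntegrable u) : ContDiff ℝ 1 (mollify ρ u) := by
  have h : ContDiff ℝ ((1 : ℕ∞) : WithTop ℕ∞) (mollify ρ u) :=
    ρ.hasCompactSupport_normed.contDiff_convolution_left _ ρ.contDiff_normed hu
  exact_mod_cast h

/-- Jensen's inequality, in the form that the variance of `u (x - ·)` under the probability density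
`ρ` is nonnegative. -/
lemma mollify_sq_le (hu : MemLp u 2) (x : E n) :
    mollify ρ u x ^ 2 ≤ mollify ρ (fun y => u y ^ 2) x := by
  set c := mollify ρ u x with hc
  have i1 := integrable_mollify_integrand ρ (hu.locallyIntegrable one_le_two) x
  have i2 := integrable_mollify_integrand ρ hu.integrable_sq.locallyIntegrable x
  have i3 : Integrable (ρ.normed (volume : Measure (E n))) := ρ.integrable_normed
  have h0 : 0 ≤ ∫ t, ρ.normed volume t * (u (x - t) - c) ^ 2 :=
    integral_nonneg fun t => mul_nonneg (ρ.nonneg_normed _) (sq_nonneg _)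
  have h1 : ∫ t, ρ.normed volume t * (u (x - t) - c) ^ 2 =
      mollify ρ (fun y => u y ^ 2) x - 2 * c * c + c ^ 2 := by
    have : ∀ t, ρ.normed volume t * (u (x - t) - c) ^ 2 =
        ρ.normed volume t * u (x - t) ^ 2 - 2 * c * (ρ.normed volume t * u (x - t))
          + c ^ 2 * ρ.normed volume t := fun t => by ring
    have i4 : Integrable fun t => ρ.normed volume t * u (x - t) ^ 2 -
      2 * c * (ρ.normed volume t * u (x - t)) := i2.sub (i1.const_mul _)
    simp_rw [this]
    rw [integral_add i4 (i3.const_mul _), integral_sub i2 (i1.const_mul _),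
      integral_const_mul, integral_const_mul, ρ.integral_normed, ← mollify_apply,
      ← mollify_apply ρ (u := fun y => u y ^ 2), ← hc, mul_one]
  rw [h1] at h0
  nlinarith

lemma integrable_mollify (hu : Integrable u) : Integrable (mollify ρ u) :=
  ρ.integrable_normed.integrable_convolution _ hu

lemma integral_mollify (hu : Integrable u) : ∫ x, mollify ρ u x = ∫ x, u x := by
  unfold mollify
  rw [integral_convolution _ ρ.integrable_normed hu, ρ.integral_normed]
  simp

/-- The derivative falls on the kernel, and the weak gradient identity is applied to the test
function `y ↦ ρ (x - y)`. Then `|⟪G, v⟫| ≤ ‖G‖ ‖v‖`. -/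
lemma norm_fderiv_mollify_le {G : E n → E n} (hu : IsSobolev u G) (x : E n) :
    ‖fderiv ℝ (mollify ρ u) x‖ ≤ mollify ρ (fun y => ‖G y‖) x := by
  have hul := hu.memLp.locallyIntegrable one_le_two
  have hGl := hu.memLp_grad.norm.locallyIntegrable one_le_two
  have hρ : ContDiff ℝ ∞ (ρ.normed (volume : Measure (E n))) := ρ.contDiff_normed
  have hρ1 : ContDiff ℝ 1 (ρ.normed (volume : Measure (E n))) := hρ.of_le (by simp)
  have hd : HasFDerivAt (mollify ρ u) _ x :=
    ρ.hasCompactSupport_normed.hasFDerivAt_convolution_left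
      (ContinuousLinearMap.lsmul ℝ ℝ) hρ1 hul x
  have hce := (ρ.hasCompactSupport_normed (μ := volume)).fderiv ℝ |>.convolutionExists_left
    ((ContinuousLinearMap.lsmul ℝ ℝ).precompL (E n)) (hρ1.continuous_fderiv one_ne_zero) hul x
  have hpos : 0 ≤ mollify ρ (fun y => ‖G y‖) x := by
    rw [mollify_apply]
    exact integral_nonneg fun t => mul_nonneg (ρ.nonneg_normed _) (norm_nonneg _)
  refine ContinuousLinearMap.opNorm_le_bound _ hpos fun v => ?_
  have e1 : fderiv ℝ (mollify ρ u) x v =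
      ∫ t, fderiv ℝ (ρ.normed volume) t v * u (x - t) := by
    rw [hd.fderiv, convolution_def, ContinuousLinearMap.integral_apply hce]
    rfl
  have e2 : ∫ t, fderiv ℝ (ρ.normed volume) t v * u (x - t) =
      ∫ y, fderiv ℝ (ρ.normed volume) (x - y) v * u y := by
    rw [← integral_sub_left_eq_self _ volume x]
    simp only [sub_sub_cancel]
  set η : E n → ℝ := fun y => ρ.normed volume (x - y) with hη
  have hηd (y : E n) : fderiv ℝ η y v = -fderiv ℝ (ρ.normed volume) (x - y) v := by
    have : HasFDerivAt η _ y := (hρ1.differentiable one_ne_zero (x - y)).hasFDerivAt.comp y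
      ((hasFDerivAt_id y).const_sub x)
    rw [this.fderiv]
    simp
  have hηs : ContDiff ℝ ∞ η := hρ.comp (contDiff_const.sub contDiff_id)
  have hηc : HasCompactSupport η :=
    ρ.hasCompactSupport_normed.comp_homeomorph (Homeomorph.subLeft x)
  have e3 := hu.weak η hηs hηc v
  simp_rw [hηd] at e3
  have e4 : fderiv ℝ (mollify ρ u) x v = ∫ y, ⟪G y, v⟫_ℝ * η y := by
    rw [e1, e2, ← neg_inj, ← e3, ← integral_neg]
    refine integral_congr_ae (ae_of_all _ fun y => ?_)
    simp only; ring
  rw [e4, mollify_apply_swap, ← integral_mul_const]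
  refine norm_integral_le_of_norm_le ?_ (ae_of_all _ fun y => ?_)
  · have := (integrable_mollify_integrand ρ hGl x).comp_sub_left x
    simp only [sub_sub_cancel] at this
    exact this.mul_const _
  · rw [norm_mul, Real.norm_eq_abs (η y), abs_of_nonneg (ρ.nonneg_normed _)]
    calc ‖⟪G y, v⟫_ℝ‖ * η y ≤ (‖G y‖ * ‖v‖) * η y := by
          gcongr
          · exact ρ.nonneg_normed _
          · exact norm_inner_le_norm _ _
      _ = _ := by simp only [hη]; ring

end Mollification

section Forms

variable {n : ℕ} {W : E n → ℝ} {M : ℝ}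

/-- Removal of the compact support assumption from a quadratic form inequality. -/
lemma form_nonneg_of_contDiff (hWc : Continuous W) (hWM : ∀ x, |W x| ≤ M)
    (H : ∀ φ : E n → ℝ, ContDiff ℝ 1 φ → HasCompactSupport φ →
      0 ≤ ∫ x, (‖fderiv ℝ φ x‖ ^ 2 + W x * φ x ^ 2))
    {φ : E n → ℝ} (hφ : ContDiff ℝ 1 φ) (h1 : Integrable fun x => φ x ^ 2)
    (h2 : Integrable fun x => ‖fderiv ℝ φ x‖ ^ 2) :
    0 ≤ ∫ x, (‖fderiv ℝ φ x‖ ^ 2 + W x * φ x ^ 2) := by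
  have hφc := hφ.continuous
  have hφ' : Continuous (fderiv ℝ φ) := hφ.continuous_fderiv one_ne_zero
  set χ : ℕ → E n → ℝ := fun k => cutoff ((k : ℝ) + 1) with hχ
  have hk (k : ℕ) : (0 : ℝ) < (k : ℝ) + 1 := by positivity
  have hχs (k : ℕ) : ContDiff ℝ 1 (χ k) := contDiff_cutoff _
  have hχc (k : ℕ) : Continuous (χ k) := (hχs k).continuous
  have hd (k : ℕ) (x : E n) : fderiv ℝ (fun x => χ k x * φ x) x =
      χ k x • fderiv ℝ φ x + φ x • fderiv ℝ (χ k) x :=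
    fderiv_fun_mul ((hχs k).differentiable one_ne_zero x) (hφ.differentiable one_ne_zero x)
  have hM0 : 0 ≤ M := (abs_nonneg _).trans (hWM 0)
  have hlim : Tendsto (fun k : ℕ => ∫ x, (‖fderiv ℝ (fun x => χ k x * φ x) x‖ ^ 2 +
      W x * (χ k x * φ x) ^ 2)) atTop (𝓝 (∫ x, (‖fderiv ℝ φ x‖ ^ 2 + W x * φ x ^ 2))) := by
    -- Since `‖∇χ‖ ≤ 4`, the product rule gives `‖∇(χ φ)‖² ≤ 2 ‖∇φ‖² + 32 φ²`, hence this dominating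
    -- function.
    apply tendsto_integral_of_dominated_convergence
      (fun x => 2 * ‖fderiv ℝ φ x‖ ^ 2 + (32 + M) * φ x ^ 2)
    · intro k
      have h3 : Continuous (fderiv ℝ (χ k)) := (hχs k).continuous_fderiv one_ne_zero
      have h4 := hχc k
      simp_rw [hd]
      exact (by fun_prop : Continuous _).aestronglyMeasurable
    · exact (h2.const_mul 2).add (h1.const_mul (32 + M))
    · refine fun k => ae_of_all _ fun x => ?_
      have c0 : 0 ≤ χ k x := cutoff_nonneg _ x
      have c1 : χ k x ≤ 1 := cutoff_le_one _ x
      have c2 : ‖fderiv ℝ (χ k) x‖ ≤ 4 := (norm_fderiv_cutoff_le (hk k) x).trans (by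
        rw [div_le_iff₀ (hk k)]
        have : (0 : ℝ) ≤ k := k.cast_nonneg
        linarith)
      have h3 : ‖fderiv ℝ (fun x => χ k x * φ x) x‖ ≤ ‖fderiv ℝ φ x‖ + |φ x| * 4 := by
        rw [hd]
        refine (norm_add_le _ _).trans ?_
        rw [norm_smul, norm_smul, Real.norm_eq_abs, Real.norm_eq_abs, abs_of_nonneg c0]
        gcongr
        exact mul_le_of_le_one_left (norm_nonneg _) c1
      have h4 : ‖fderiv ℝ (fun x => χ k x * φ x) x‖ ^ 2 ≤
          2 * ‖fderiv ℝ φ x‖ ^ 2 + 32 * φ x ^ 2 := by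
        have := pow_le_pow_left₀ (norm_nonneg _) h3 2
        nlinarith [sq_nonneg (‖fderiv ℝ φ x‖ - |φ x| * 4), sq_abs (φ x)]
      have h5 : |W x * (χ k x * φ x) ^ 2| ≤ M * φ x ^ 2 := by
        rw [abs_mul, abs_of_nonneg (sq_nonneg (χ k x * φ x)), mul_pow]
        have : χ k x ^ 2 * φ x ^ 2 ≤ φ x ^ 2 :=
          mul_le_of_le_one_left (sq_nonneg _) (pow_le_one₀ c0 c1)
        exact mul_le_mul (hWM x) this (by positivity) hM0
      refine (norm_add_le _ _).trans ?_
      rw [Real.norm_eq_abs, Real.norm_eq_abs, abs_of_nonneg (sq_nonneg _)]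
      linarith
    · refine ae_of_all _ fun x => ?_
      have l1 : Tendsto (fun k => χ k x) atTop (𝓝 1) := tendsto_cutoff x
      have l2 : Tendsto (fun k => fderiv ℝ (χ k) x) atTop (𝓝 0) := by
        refine squeeze_zero_norm (fun k => norm_fderiv_cutoff_le (hk k) x) ?_
        exact tendsto_const_nhds.div_atTop
          (tendsto_atTop_add_const_right _ _ tendsto_natCast_atTop_atTop)
      simp_rw [hd]
      have l3 := (((l1.smul_const (fderiv ℝ φ x)).add (l2.const_smul (φ x))).norm.pow 2).add
        (((l1.mul_const (φ x)).pow 2).const_mul (W x))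
      simpa using l3
  refine ge_of_tendsto hlim (Eventually.of_forall fun k => H _ ((hχs k).mul hφ) ?_)
  exact (hasCompactSupport_cutoff (hk k)).mul_right

/-- A quadratic form inequality for compactly supported `C¹` functions extends to `L²₁`. -/
theorem form_le_of_isSobolev {μ A : ℝ} (hμ : 0 ≤ μ) (hA : 0 ≤ A) {V : E n → ℝ}
    (hVc : Continuous V) (hV0 : ∀ x, 0 ≤ V x) (hVM : ∀ x, V x ≤ M)
    (H : ∀ φ : E n → ℝ, ContDiff ℝ 1 φ → HasCompactSupport φ →
      0 ≤ ∫ x, (‖fderiv ℝ φ x‖ ^ 2 + (μ - A * V x) * φ x ^ 2))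
    {b : E n → ℝ} {G : E n → E n} (hb : IsSobolev b G) :
    A * ∫ x, V x * b x ^ 2 ≤ (∫ x, ‖G x‖ ^ 2) + μ * ∫ x, b x ^ 2 := by
  have hbl := hb.memLp.locallyIntegrable one_le_two
  have hb2 := hb.memLp.integrable_sq
  have hG2 := hb.memLp_grad.norm.integrable_sq
  let ρ : ℕ → ContDiffBump (0 : E n) := fun k =>
    ⟨1 / ((k : ℝ) + 1), 2 / ((k : ℝ) + 1), by positivity, by gcongr; norm_num⟩
  have hρ : Tendsto (fun k => (ρ k).rOut) atTop (𝓝 0) :=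
    tendsto_const_nhds.div_atTop
      (tendsto_atTop_add_const_right _ _ tendsto_natCast_atTop_atTop)
  have hae : ∀ᵐ x, Tendsto (fun k => mollify (ρ k) b x) atTop (𝓝 (b x)) :=
    ContDiffBump.ae_convolution_tendsto_right_of_locallyIntegrable (K := 2) hρ
      (Eventually.of_forall fun k => by simp only [ρ]; rw [mul_one_div]) hbl
  have hs (k : ℕ) := contDiff_mollify (ρ k) hbl
  have hs0 (k : ℕ) := (hs k).continuous
  have hs' (k : ℕ) : Continuous (fderiv ℝ (mollify (ρ k) b)) :=
    (hs k).continuous_fderiv one_ne_zero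
  have i1 (k : ℕ) : Integrable fun x => mollify (ρ k) b x ^ 2 := by
    refine (integrable_mollify (ρ k) hb2).mono' ?_ (ae_of_all _ fun x => ?_)
    · have := hs0 k
      exact (by fun_prop : Continuous _).aestronglyMeasurable
    · rw [Real.norm_eq_abs, abs_of_nonneg (sq_nonneg _)]
      exact mollify_sq_le _ hb.memLp x
  have d1 (k : ℕ) (x : E n) : ‖fderiv ℝ (mollify (ρ k) b) x‖ ^ 2 ≤
      mollify (ρ k) (fun y => ‖G y‖ ^ 2) x :=
    (pow_le_pow_left₀ (norm_nonneg _) (norm_fderiv_mollify_le (ρ k) hb x) 2).trans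
      (mollify_sq_le (ρ k) hb.memLp_grad.norm x)
  have i2 (k : ℕ) : Integrable fun x => ‖fderiv ℝ (mollify (ρ k) b) x‖ ^ 2 := by
    refine (integrable_mollify (ρ k) hG2).mono' ?_ (ae_of_all _ fun x => ?_)
    · have := hs' k
      exact (by fun_prop : Continuous _).aestronglyMeasurable
    · rw [Real.norm_eq_abs, abs_of_nonneg (sq_nonneg _)]
      exact d1 k x
  have i3 (k : ℕ) : Integrable fun x => V x * mollify (ρ k) b x ^ 2 :=
    (i1 k).bdd_mul hVc.aestronglyMeasurable (ae_of_all _ fun x => by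
      rw [Real.norm_eq_abs, abs_of_nonneg (hV0 x)]; exact hVM x)
  -- Mollification does not increase the `L²` norms on the right. The left integrand is nonnegative,
  -- so Fatou's lemma and a.e. convergence suffice for the limit.
  have key (k : ℕ) : ∫ x, A * (V x * mollify (ρ k) b x ^ 2) ≤
      (∫ x, ‖G x‖ ^ 2) + μ * ∫ x, b x ^ 2 := by
    have h0 := form_nonneg_of_contDiff (W := fun x => μ - A * V x) (M := μ + A * M)
      (by fun_prop) (fun x => by
        refine (abs_sub _ _).trans ?_
        rw [abs_of_nonneg hμ, abs_mul, abs_of_nonneg hA, abs_of_nonneg (hV0 x)]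
        gcongr
        exact hVM x) H (hs k) (i1 k) (i2 k)
    have e : ∀ x, ‖fderiv ℝ (mollify (ρ k) b) x‖ ^ 2 + (μ - A * V x) * mollify (ρ k) b x ^ 2 =
        ‖fderiv ℝ (mollify (ρ k) b) x‖ ^ 2 + μ * mollify (ρ k) b x ^ 2 -
          A * (V x * mollify (ρ k) b x ^ 2) := fun x => by ring
    have i4 : Integrable fun x => ‖fderiv ℝ (mollify (ρ k) b) x‖ ^ 2 +
      μ * mollify (ρ k) b x ^ 2 := (i2 k).add ((i1 k).const_mul _)
    simp_rw [e] at h0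
    rw [integral_sub i4 ((i3 k).const_mul _),
      integral_add (i2 k) ((i1 k).const_mul _), integral_const_mul μ] at h0
    have b1 := integral_mono (i2 k) (integrable_mollify (ρ k) hG2) (d1 k)
    have b2 := integral_mono (i1 k) (integrable_mollify (ρ k) hb2)
      (mollify_sq_le (ρ k) hb.memLp)
    rw [integral_mollify _ hG2] at b1
    rw [integral_mollify _ hb2] at b2
    have b3 := mul_le_mul_of_nonneg_left b2 hμ
    linarith
  rw [← integral_const_mul]
  refine integral_le_of_ae_tendsto (fun k => (i3 k).const_mul A)
    (fun k x => mul_nonneg hA (mul_nonneg (hV0 x) (sq_nonneg _))) key ?_ ?_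
  · exact (hVc.aestronglyMeasurable.mul (hb.memLp.1.pow 2)).const_mul A
  · filter_upwards [hae] with x hx
    exact ((hx.pow 2).const_mul _).const_mul _

end Forms

/-! ### The radial minimizer -/

/-- For a positive decreasing radial potential `V` vanishing at infinity, the quotient
`∫ (|∇b|² + μ b²) / ∫ V b²` has a positive, radially decreasing minimizer on `L²₁(ℝⁿ)`. -/
theorem exists_radial_minimizer {n : ℕ} (hn : 1 ≤ n) {μ : ℝ} (hμ : 0 < μ) {V : ℝ → ℝ}
    (hVc : Continuous V) (hV0 : ∀ r, 0 < V r) {M : ℝ} (hVM : ∀ r, V r ≤ M)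
    (hVa : AntitoneOn V (Set.Ici 0)) (hV : Tendsto V atTop (𝓝 0)) :
    ∃ (A : ℝ) (B : ℝ → ℝ) (X : E n → E n),
      (∀ (b : E n → ℝ) (G : E n → E n), IsSobolev b G →
        A * ∫ x, V ‖x‖ * b x ^ 2 ≤ (∫ x, ‖G x‖ ^ 2) + μ * ∫ x, b x ^ 2) ∧
      IsSobolev (fun x : E n => B ‖x‖) X ∧ (∀ r, 0 ≤ r → 0 < B r) ∧ AntitoneOn B (Set.Ici 0) ∧
      (∫ x, ‖X x‖ ^ 2) + μ * (∫ x : E n, B ‖x‖ ^ 2) ≤ A * ∫ x : E n, V ‖x‖ * B ‖x‖ ^ 2 := by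
  -- Picone's inequality for one fixed function `φ` bounds every admissible `A` by the quotient of
  -- `φ`.
  have hA₁ : ∃ A₁ : ℝ, ∀ A B, 0 ≤ A → IsRadialSolution n (fun r => μ - A * V r) B →
      (∀ r, 0 ≤ r → 0 < B r) → A ≤ A₁ := by
    have hφ := contDiff_cutoff (n := n) 1
    have hφc := hasCompactSupport_cutoff (n := n) one_pos
    set φ : E n → ℝ := cutoff 1
    have hφ0 := hφ.continuous
    have hφ' : Continuous (fderiv ℝ φ) := hφ.continuous_fderiv one_ne_zero
    have s2 : HasCompactSupport fun x => φ x ^ 2 :=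
      hφc.comp_left (g := fun t : ℝ => t ^ 2) (by simp)
    have i1 : Integrable fun x => ‖fderiv ℝ φ x‖ ^ 2 + μ * φ x ^ 2 := by
      refine Integrable.add ?_ ?_
      · refine Continuous.integrable_of_hasCompactSupport (by fun_prop) ?_
        exact (hφc.fderiv ℝ).comp_left (g := fun L : E n →L[ℝ] ℝ => ‖L‖ ^ 2) (by simp)
      · exact Continuous.integrable_of_hasCompactSupport (by fun_prop) s2.mul_left
    have i2 : Integrable fun x => V ‖x‖ * φ x ^ 2 :=
      Continuous.integrable_of_hasCompactSupport (by fun_prop) s2.mul_left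
    have hpos : 0 < ∫ x, V ‖x‖ * φ x ^ 2 := by
      apply Continuous.integral_pos_of_hasCompactSupport_nonneg_nonzero (x := 0)
        (by fun_prop) s2.mul_left
      · exact fun x => mul_nonneg (hV0 _).le (sq_nonneg _)
      · have : φ 0 = 1 := by simp [φ, cutoff]
        simpa [this] using (hV0 0).ne'
    refine ⟨(∫ x, (‖fderiv ℝ φ x‖ ^ 2 + μ * φ x ^ 2)) / ∫ x, V ‖x‖ * φ x ^ 2,
      fun A B hA h hB => ?_⟩
    have h0 := h.integral_picone_nonneg hn hB hφ hφc
    have e : ∀ x, ‖fderiv ℝ φ x‖ ^ 2 + (μ - A * V ‖x‖) * φ x ^ 2 =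
        ‖fderiv ℝ φ x‖ ^ 2 + μ * φ x ^ 2 - A * (V ‖x‖ * φ x ^ 2) := fun x => by ring
    simp_rw [e] at h0
    rw [integral_sub i1 (i2.const_mul _), integral_const_mul] at h0
    rw [le_div_iff₀ hpos]
    linarith
  obtain ⟨A₁, hA₁⟩ := hA₁
  obtain ⟨A, B, hA, h, hB, hg⟩ :=
    exists_decreasing_radialSolution hn hμ hVc hV0 hVM hVa hV hA₁
  obtain ⟨R₀, hR₀⟩ : ∃ R₀, ∀ r, R₀ ≤ r → μ / 2 ≤ μ - A * V r := by
    have : ∀ᶠ r in atTop, A * V r < μ / 2 := by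
      have h1 := hV.const_mul A
      rw [mul_zero] at h1
      exact h1.eventually_lt_const (by positivity)
    obtain ⟨R₀, hR₀⟩ := eventually_atTop.1 this
    exact ⟨R₀, fun r hr => by linarith [hR₀ r hr]⟩
  obtain ⟨j1, j2⟩ := h.integrable_energy (n := n) hn hB hg (half_pos hμ) hR₀
  have j3 : Integrable fun x : E n => V ‖x‖ * B ‖x‖ ^ 2 :=
    j1.bdd_mul (hVc.comp continuous_norm).aestronglyMeasurable (ae_of_all _ fun x => by
      rw [Real.norm_eq_abs, abs_of_pos (hV0 _)]
      exact hVM _)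
  have e : ∀ x : E n, radialMean n (fun σ => (μ - A * V σ) * B σ) ‖x‖ ^ 2 * ‖x‖ ^ 2 +
      (μ - A * V ‖x‖) * B ‖x‖ ^ 2 =
      radialMean n (fun σ => (μ - A * V σ) * B σ) ‖x‖ ^ 2 * ‖x‖ ^ 2 + μ * B ‖x‖ ^ 2 -
        A * (V ‖x‖ * B ‖x‖ ^ 2) := fun x => by ring
  have j4 : Integrable fun x : E n =>
      radialMean n (fun σ => (μ - A * V σ) * B σ) ‖x‖ ^ 2 * ‖x‖ ^ 2 + μ * B ‖x‖ ^ 2 :=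
    j2.add (j1.const_mul μ)
  have hen := h.integral_energy_nonpos (n := n) hn hB hg (by
    simp_rw [e]
    exact j4.sub (j3.const_mul A))
  simp_rw [e] at hen
  rw [integral_sub j4 (j3.const_mul A), integral_add j2 (j1.const_mul μ), integral_const_mul,
    integral_const_mul] at hen
  refine ⟨A, B, _, fun b G hbG => ?_, h.isSobolev j1 j2, hB, h.antitoneOn hg, ?_⟩
  · exact form_le_of_isSobolev hμ.le hA (V := fun x => V ‖x‖) (by fun_prop) (fun x => (hV0 _).le)
      (fun x => hVM _) (fun φ hφ hφc => h.integral_picone_nonneg hn hB hφ hφc) hbG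
  · simp only [norm_smul, mul_pow, Real.norm_eq_abs, sq_abs]
    linarith

/-! ### Radial monotonicity of the Yamabe solution -/

/-- The Laplacian of a radial function. -/
lemma laplacian_comp_norm {n : ℕ} {F : ℝ → ℝ} (hF : ContDiff ℝ 2 F) {f : E n → ℝ}
    (hf : ContDiff ℝ 2 f) (hfF : ∀ x, f x = F ‖x‖) {x : E n} (hx : x ≠ 0) :
    (Δ f) x = deriv (deriv F) ‖x‖ + (n - 1) / ‖x‖ * deriv F ‖x‖ := by
  have hx' : ‖x‖ ≠ 0 := norm_ne_zero_iff.2 hx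
  have hF1 : Differentiable ℝ F := hF.differentiable two_ne_zero
  have hF2 : Differentiable ℝ (deriv F) :=
    (hF.deriv' (n := 1)).differentiable one_ne_zero
  have hf1 : Differentiable ℝ f := hf.differentiable two_ne_zero
  have hf2 : Differentiable ℝ (fderiv ℝ f) :=
    (hf.fderiv_right (m := 1) (by norm_num)).differentiable one_ne_zero
  have h1 (y : E n) (hy : y ≠ 0) (i : Fin n) :
      fderiv ℝ f y (EuclideanSpace.single i 1) = deriv F ‖y‖ / ‖y‖ * y i := by
    have a1 := (hf1 y).hasFDerivAt.hasLineDerivAt (EuclideanSpace.single i (1 : ℝ))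
    have a0 : HasDerivAt F (deriv F ‖y‖) ‖y + (0 : ℝ) • EuclideanSpace.single i (1 : ℝ)‖ := by
      simpa using (hF1 ‖y‖).hasDerivAt
    have a2 := a0.comp (0 : ℝ) (hasLineDerivAt_norm hy (EuclideanSpace.single i (1 : ℝ)))
    have a3 : HasLineDerivAt ℝ f (deriv F ‖y‖ * (⟪y, EuclideanSpace.single i 1⟫_ℝ / ‖y‖)) y
        (EuclideanSpace.single i 1) :=
      a2.congr_of_eventuallyEq (Eventually.of_forall fun t => hfF _)
    rw [HasDerivAt.unique a1 a3, EuclideanSpace.inner_single_right]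
    simp
    ring
  have hk : HasDerivAt (fun r => deriv F r / r)
      ((deriv (deriv F) ‖x‖ * ‖x‖ - deriv F ‖x‖) / ‖x‖ ^ 2) ‖x‖ := by
    refine ((hF2 ‖x‖).hasDerivAt.div (hasDerivAt_id _) hx').congr_deriv ?_
    simp
  have h2 (i : Fin n) : fderiv ℝ (fderiv ℝ f) x (EuclideanSpace.single i 1)
      (EuclideanSpace.single i 1) = deriv F ‖x‖ / ‖x‖ +
        (deriv (deriv F) ‖x‖ * ‖x‖ - deriv F ‖x‖) / ‖x‖ ^ 2 * (x i ^ 2 / ‖x‖) := by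
    have a1 : HasLineDerivAt ℝ (fun y => fderiv ℝ f y (EuclideanSpace.single i 1))
        (fderiv ℝ (fderiv ℝ f) x (EuclideanSpace.single i 1) (EuclideanSpace.single i 1)) x
        (EuclideanSpace.single i 1) := by
      have b1 : HasFDerivAt (fun y => fderiv ℝ f y (EuclideanSpace.single i 1)) _ x :=
        (hf2 x).hasFDerivAt.clm_apply (hasFDerivAt_const (EuclideanSpace.single i (1 : ℝ)) x)
      refine HasDerivAt.congr_deriv (b1.hasLineDerivAt (EuclideanSpace.single i (1 : ℝ))) ?_
      simp
    refine HasDerivAt.unique a1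
      (HasDerivAt.congr_of_eventuallyEq (hasLineDerivAt_comp_norm_mul_coord hx hk i) ?_)
    have hc : Continuous fun t : ℝ => x + t • EuclideanSpace.single i (1 : ℝ) := by fun_prop
    have : ∀ᶠ t : ℝ in 𝓝 0, x + t • EuclideanSpace.single i (1 : ℝ) ≠ 0 :=
      hc.continuousAt.eventually_ne (by simpa using hx)
    filter_upwards [this] with t ht
    exact h1 _ ht i
  rw [InnerProductSpace.laplacian_eq_iteratedFDeriv_orthonormalBasis f (EuclideanSpace.basisFun (Fin n) ℝ)]
  simp only [iteratedFDeriv_two_apply, EuclideanSpace.basisFun_apply, Matrix.cons_val_zero,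
    Matrix.cons_val_one, h2]
  rw [Finset.sum_add_distrib, ← Finset.mul_sum]
  have h3 : ∑ i, x i ^ 2 / ‖x‖ = ‖x‖ := by
    have := sum_sq_div_norm_sq hx
    rw [← Finset.sum_div, div_eq_one_iff_eq (by positivity)] at this
    rw [← Finset.sum_div, this]
    field_simp
  rw [h3]
  simp
  field_simp
  ring

/-- Positive radial solutions of `-a Δ f + s f = s f^{p-1}` vanishing at infinity are radially
decreasing. -/
theorem antitoneOn_of_radial_equation {a s p : ℝ} (ha : 0 < a) (hs : 0 < s) (hp : 2 < p) {n : ℕ}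
    (hn : 1 ≤ n) {F : ℝ → ℝ} (hF : ContDiff ℝ 2 F) (hpos : ∀ t, 0 < F t) (hF0 : deriv F 0 = 0)
    (hlim : Tendsto F atTop (𝓝 0))
    (hode : ∀ t, 0 < t → a * (deriv (deriv F) t + (n - 1) / t * deriv F t) =
      s * (F t - F t ^ (p - 1))) :
    AntitoneOn F (Set.Ici 0) := by
  have hn1 : (1 : ℝ) ≤ n := by exact_mod_cast hn
  have hFc : Continuous F := hF.continuous
  have hF1 : Differentiable ℝ F := hF.differentiable two_ne_zero
  have hF1c : Continuous (deriv F) := (hF.deriv' (n := 1)).continuous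
  have hF2 : Differentiable ℝ (deriv F) := (hF.deriv' (n := 1)).differentiable one_ne_zero
  -- the energy is nonincreasing and nonnegative
  set En : ℝ → ℝ := fun t => a / 2 * deriv F t ^ 2 + s * (F t ^ p / p - F t ^ 2 / 2) with hEn
  have hEd (t : ℝ) : HasDerivAt En (deriv F t *
      (a * deriv (deriv F) t - s * (F t - F t ^ (p - 1)))) t := by
    have h1 := ((hF2 t).hasDerivAt.pow 2).const_mul (a / 2)
    have h2 := (((hF1 t).hasDerivAt.rpow_const (p := p) (Or.inl (hpos t).ne')).div_const p).sub
      (((hF1 t).hasDerivAt.pow 2).div_const 2)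
    refine (h1.add (h2.const_mul s)).congr_deriv ?_
    field_simp
    push_cast
    ring
  have hEa : AntitoneOn En (Set.Ici 0) := by
    apply antitoneOn_of_deriv_nonpos (convex_Ici _)
    · exact fun t _ => (hEd t).continuousAt.continuousWithinAt
    · exact fun t _ => (hEd t).differentiableAt.differentiableWithinAt
    · intro t ht
      rw [interior_Ici] at ht
      have ht : 0 < t := ht
      rw [(hEd t).deriv, ← hode t ht]
      have : 0 ≤ a * ((n - 1) / t * deriv F t ^ 2) :=
        mul_nonneg ha.le (mul_nonneg (div_nonneg (by linarith) ht.le) (sq_nonneg _))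
      nlinarith
  have hE0 (t : ℝ) (ht : 0 ≤ t) : 0 ≤ En t := by
    have h1 : Tendsto (fun r => s * (F r ^ p / p - F r ^ 2 / 2)) atTop (𝓝 0) := by
      have := (((hlim.rpow_const (p := p) (Or.inr (by linarith))).div_const p).sub
        ((hlim.pow 2).div_const 2)).const_mul s
      simpa [Real.zero_rpow (show p ≠ 0 by linarith)] using this
    refine le_of_tendsto h1 ?_
    filter_upwards [eventually_ge_atTop t] with r hr
    have h2 := hEa (Set.mem_Ici.2 ht) (Set.mem_Ici.2 (ht.trans hr)) hr
    have h3 : 0 ≤ a / 2 * deriv F r ^ 2 := by positivity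
    simp only [hEn] at h2 ⊢
    linarith
  -- At a critical point, nonnegative energy forces `F^{p-2} ≥ p/2 > 1`.
  have hcrit (t : ℝ) (ht : 0 ≤ t) (h0 : deriv F t = 0) : F t - F t ^ (p - 1) < 0 := by
    have h1 := hE0 t ht
    simp only [hEn, h0] at h1
    have h2 : 0 ≤ F t ^ p / p - F t ^ 2 / 2 :=
      nonneg_of_mul_nonneg_right (by simpa using h1) hs
    have h3 : F t ^ p = F t ^ (p - 1) * F t := by
      rw [← Real.rpow_add_one (hpos t).ne']; ring_nf
    rw [h3, sub_nonneg, div_le_div_iff₀ two_pos (by linarith)] at h2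
    have h4 : F t * p ≤ F t ^ (p - 1) * 2 := by
      have : (F t * p) * F t ≤ (F t ^ (p - 1) * 2) * F t := by linarith
      exact le_of_mul_le_mul_right this (hpos t)
    nlinarith [hpos t]
  -- If `F' > 0` at `t₂`, take the last earlier point `t₀` with `F' ≤ 0`. There `F' = 0`, so by
  -- `hcrit` and the equation `t^{n-1} F'` strictly decreases just after `t₀`, although `F' > 0`
  -- there.
  have hmain (t₂ : ℝ) (ht₂ : 0 ≤ t₂) : deriv F t₂ ≤ 0 := by
    by_contra! hc
    let K := Set.Icc 0 t₂ ∩ {t | deriv F t ≤ 0}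
    have hK : IsCompact K := isCompact_Icc.inter_right (isClosed_le hF1c continuous_const)
    obtain ⟨t₀, ⟨⟨h1, h2⟩, h3⟩, hmax⟩ := hK.exists_isGreatest ⟨0, ⟨le_rfl, ht₂⟩, hF0.le⟩
    have h3 : deriv F t₀ ≤ 0 := h3
    have hlt : t₀ < t₂ := lt_of_le_of_ne h2 (by rintro rfl; linarith)
    have hpos' (t : ℝ) (ht : t ∈ Set.Ioo t₀ t₂) : 0 < deriv F t := by
      by_contra! hc'
      exact absurd (hmax ⟨⟨h1.trans ht.1.le, ht.2.le⟩, hc'⟩) (not_le.2 ht.1)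
    have hz : deriv F t₀ = 0 := by
      refine le_antisymm h3 (ge_of_tendsto
        (hF1c.continuousAt.tendsto.mono_left (nhdsWithin_le_nhds (s := Set.Ioi t₀))) ?_)
      filter_upwards [Ioo_mem_nhdsGT hlt] with t ht using (hpos' t ht).le
    have hneg : ∀ᶠ t in 𝓝 t₀, F t - F t ^ (p - 1) < 0 :=
      (hFc.sub (hFc.rpow_const fun x => Or.inl (hpos x).ne')).continuousAt.eventually_lt_const
        (hcrit t₀ h1 hz)
    obtain ⟨δ, hδ, hball⟩ := Metric.eventually_nhds_iff.1 hneg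
    set t₁ := min t₂ (t₀ + δ) with ht₁
    have ht₀₁ : t₀ < t₁ := lt_min hlt (by linarith)
    have hPd (t : ℝ) (ht : 0 < t) : HasDerivAt (fun t => t ^ (n - 1) * deriv F t)
        (t ^ (n - 1) * (s / a * (F t - F t ^ (p - 1)))) t := by
      refine ((hasDerivAt_pow (n - 1) t).mul (hF2 t).hasDerivAt).congr_deriv ?_
      have h4 := hode t ht
      have h5 : s / a * (F t - F t ^ (p - 1)) =
          deriv (deriv F) t + (n - 1) / t * deriv F t := by
        rw [div_mul_eq_mul_div, ← h4]; field_simp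
      rw [h5]
      obtain ⟨k, rfl⟩ : ∃ k, n = k + 1 := ⟨n - 1, by omega⟩
      rcases k with _ | k
      · simp
      · simp only [Nat.add_sub_cancel]
        push_cast
        field_simp
        ring
    have hanti : StrictAntiOn (fun t => t ^ (n - 1) * deriv F t) (Set.Icc t₀ t₁) := by
      apply strictAntiOn_of_deriv_neg (convex_Icc _ _) (by fun_prop)
      intro t ht
      rw [interior_Icc] at ht
      have ht0 : 0 < t := h1.trans_lt ht.1
      rw [(hPd t ht0).deriv]
      have h4 : t < t₀ + δ := ht.2.trans_le (min_le_right _ _)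
      have h5 := hball (y := t) (by rw [Real.dist_eq, abs_of_pos (by linarith [ht.1])]; linarith)
      exact mul_neg_of_pos_of_neg (pow_pos ht0 _) (mul_neg_of_pos_of_neg (by positivity) h5)
    obtain ⟨t, ht⟩ := exists_between ht₀₁
    have h4 := hanti (Set.left_mem_Icc.2 ht₀₁.le) ⟨ht.1.le, ht.2.le⟩ ht.1
    simp only [hz, mul_zero] at h4
    have h5 := mul_pos (pow_pos (h1.trans_lt ht.1) (n - 1))
      (hpos' t ⟨ht.1, ht.2.trans_le (min_le_left _ _)⟩)
    linarith
  apply antitoneOn_of_deriv_nonpos (convex_Ici _) hFc.continuousOn hF1.differentiableOn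
  intro t ht
  rw [interior_Ici] at ht
  exact hmain t (le_of_lt ht)

/-! ### Application to the Yamabe quotient -/

namespace EuclideanYamabe

lemma a_pos {N : ℕ} (hN : 3 ≤ N) : 0 < a N := by
  have : (3 : ℝ) ≤ N := by exact_mod_cast hN
  unfold a
  apply div_pos <;> linarith

lemma two_lt_p {N : ℕ} (hN : 3 ≤ N) : 2 < p N := by
  have : (3 : ℝ) ≤ N := by exact_mod_cast hN
  unfold p
  rw [lt_div_iff₀ (by linarith)]
  linarith

/-- The radial profile of the Yamabe solution is decreasing. -/
lemma IsYamabeSolution.exists_profile {m n : ℕ} (hm : 2 ≤ m) (hn : 2 ≤ n) {s : ℝ} (hs : 0 < s)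
    {f : E n → ℝ} (hf : IsYamabeSolution m n s f) :
    ∃ F : ℝ → ℝ, Continuous F ∧ (∀ t, 0 < F t) ∧ (∀ t, F t = F |t|) ∧ (∀ x, f x = F ‖x‖) ∧
      Tendsto F atTop (𝓝 0) ∧ AntitoneOn F (Set.Ici 0) := by
  set e : E n := EuclideanSpace.single ⟨0, by omega⟩ 1 with he
  have hen : ‖e‖ = 1 := by simp [he]
  have hne (t : ℝ) : ‖t • e‖ = |t| := by rw [norm_smul, hen, mul_one, Real.norm_eq_abs]
  set F : ℝ → ℝ := fun t => f (t • e) with hFd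
  have hF : ContDiff ℝ 2 F := hf.contDiff.comp (by fun_prop)
  have hfF (x : E n) : f x = F ‖x‖ := hf.radial _ _ (by rw [hne, abs_norm])
  have heven (t : ℝ) : F t = F |t| := hf.radial _ _ (by rw [hne, hne, abs_abs])
  have hlim : Tendsto F atTop (𝓝 0) := by
    refine hf.tendsto_zero.comp ?_
    rw [← Metric.cobounded_eq_cocompact, ← tendsto_norm_atTop_iff_cobounded]
    simp_rw [hne]
    exact tendsto_abs_atTop_atTop
  have hF0 : deriv F 0 = 0 := by
    have h1 : (fun t => F (-t)) = F := by
      ext t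
      rw [heven (-t), abs_neg, ← heven]
    have h2 := deriv_comp_neg F 0
    rw [h1, neg_zero] at h2
    linarith
  refine ⟨F, hF.continuous, fun t => hf.pos _, heven, hfF, hlim,
    antitoneOn_of_radial_equation (a_pos (by omega : 3 ≤ m + n)) hs
      (two_lt_p (by omega : 3 ≤ m + n)) (by omega : 1 ≤ n) hF (fun t => hf.pos _) hF0 hlim
      fun t ht => ?_⟩
  have hte : ‖t • e‖ = t := by rw [hne, abs_of_pos ht]
  have h1 := hf.equation (t • e)
  rw [laplacian_comp_norm hF hf.contDiff hfF (by rw [← norm_ne_zero_iff, hte]; exact ht.ne'),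
    hfF, hte] at h1
  linarith

end EuclideanYamabe

theorem lemma4p2 (m n : ℕ) (hm : 2 ≤ m) (hn : 2 ≤ n) (s : ℝ) (hs : 0 < s)
    (f : EuclideanYamabe.E n → ℝ) (hf : EuclideanYamabe.IsYamabeSolution m n s f)
    (lam : ℝ) (hlam : 0 ≤ lam) :
    s * f 0 ^ (2 - EuclideanYamabe.p (m + n)) ≤ EuclideanYamabe.A m s f lam ∧
    ∃ (b : EuclideanYamabe.E n → ℝ) (G : EuclideanYamabe.E n → EuclideanYamabe.E n),
      EuclideanYamabe.IsSobolev b G ∧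
      ¬ (b =ᵐ[volume] 0) ∧
      (∀ x y, ‖x‖ ≤ ‖y‖ → b y ≤ b x) ∧
      EuclideanYamabe.quotient m s f lam b G = EuclideanYamabe.A m s f lam := by
  obtain ⟨F, hFc, hF0, hFe, hfF, hFlim, hFa⟩ := hf.exists_profile hm hn hs
  set a := EuclideanYamabe.a (m + n) with ha_def
  set p := EuclideanYamabe.p (m + n) with hp_def
  have ha : 0 < a := EuclideanYamabe.a_pos (by omega)
  have hp : 0 < p - 2 := sub_pos.2 (EuclideanYamabe.two_lt_p (by omega))
  set V : ℝ → ℝ := fun r => F r ^ (p - 2) with hV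
  have hVc : Continuous V := hFc.rpow_const fun r => Or.inl (hF0 r).ne'
  have hV0 (r : ℝ) : 0 < V r := Real.rpow_pos_of_pos (hF0 r) _
  have hVM (r : ℝ) : V r ≤ V 0 := by
    refine Real.rpow_le_rpow (hF0 r).le ?_ hp.le
    rw [hFe r]
    exact hFa Set.self_mem_Ici (Set.mem_Ici.2 (abs_nonneg r)) (abs_nonneg r)
  have hVa : AntitoneOn V (Set.Ici 0) := fun r hr t ht hrt =>
    Real.rpow_le_rpow (hF0 t).le (hFa hr ht hrt) hp.le
  have hVlim : Tendsto V atTop (𝓝 0) := by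
    have := hFlim.rpow_const (p := p - 2) (Or.inr hp.le)
    rwa [Real.zero_rpow hp.ne'] at this
  have hμ : 0 < (s + lam) / a := by positivity
  obtain ⟨A, B, X, hle, hBS, hB, hBa, hmin⟩ :=
    exists_radial_minimizer (n := n) (by omega) hμ hVc hV0 hVM hVa hVlim
  have hVi {b : E n → ℝ} {G : E n → E n} (hb : IsSobolev b G) :
      Integrable fun x => V ‖x‖ * b x ^ 2 :=
    hb.memLp.integrable_sq.bdd_mul (hVc.comp continuous_norm).aestronglyMeasurable
      (ae_of_all _ fun x => by
        rw [Real.norm_eq_abs, abs_of_pos (hV0 _)]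
        exact hVM _)
  have hD {b : E n → ℝ} {G : E n → E n} (hb : IsSobolev b G) (hb0 : ¬ b =ᵐ[volume] 0) :
      0 < ∫ x, V ‖x‖ * b x ^ 2 := by
    have h0 : ∀ x, 0 ≤ V ‖x‖ * b x ^ 2 := fun x => mul_nonneg (hV0 _).le (sq_nonneg _)
    refine lt_of_le_of_ne (integral_nonneg h0) fun h => hb0 ?_
    have := (integral_eq_zero_iff_of_nonneg h0 (hVi hb)).1 h.symm
    filter_upwards [this] with x hx
    simpa [(hV0 ‖x‖).ne'] using hx
  have hquot {b : E n → ℝ} {G : E n → E n} (hb : IsSobolev b G) :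
      EuclideanYamabe.quotient m s f lam b G =
        a * ((∫ x, ‖G x‖ ^ 2) + (s + lam) / a * ∫ x, b x ^ 2) / ∫ x, V ‖x‖ * b x ^ 2 := by
    have i1 := hb.memLp_grad.norm.integrable_sq
    have i2 := hb.memLp.integrable_sq
    unfold EuclideanYamabe.quotient
    simp only [hfF, ← ha_def, ← hp_def]
    rw [integral_add (i1.const_mul a) (i2.const_mul s), integral_const_mul, integral_const_mul,
      ← mul_div_assoc, ← add_div]
    congr 1
    field_simp
    ring
  have hlow {b : E n → ℝ} {G : E n → E n} (hb : IsSobolev b G) (hb0 : ¬ b =ᵐ[volume] 0) :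
      a * A ≤ EuclideanYamabe.quotient m s f lam b G := by
    rw [hquot hb, le_div_iff₀ (hD hb hb0), mul_assoc]
    exact mul_le_mul_of_nonneg_left (hle b G hb) ha.le
  -- The gradient and `lam` terms are nonnegative and are dropped; what remains is `∫ V b² ≤ V(0) ∫
  -- b²`.
  have hlow' {b : E n → ℝ} {G : E n → E n} (hb : IsSobolev b G) (hb0 : ¬ b =ᵐ[volume] 0) :
      s * f 0 ^ (2 - p) ≤ EuclideanYamabe.quotient m s f lam b G := by
    have h1 : f 0 ^ (2 - p) = (V 0)⁻¹ := by
      rw [hfF 0, norm_zero, hV, ← Real.rpow_neg (hF0 0).le, neg_sub]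
    have h2 : ∫ x, V ‖x‖ * b x ^ 2 ≤ V 0 * ∫ x, b x ^ 2 := by
      rw [← integral_const_mul]
      exact integral_mono (hVi hb) (hb.memLp.integrable_sq.const_mul _) fun x =>
        mul_le_mul_of_nonneg_right (hVM _) (sq_nonneg _)
    have h3 : 0 ≤ ∫ x, ‖G x‖ ^ 2 := integral_nonneg fun x => sq_nonneg _
    have h4 : 0 ≤ ∫ x, b x ^ 2 := integral_nonneg fun x => sq_nonneg _
    rw [h1, hquot hb, le_div_iff₀ (hD hb hb0)]
    calc s * (V 0)⁻¹ * ∫ x, V ‖x‖ * b x ^ 2 ≤ s * (V 0)⁻¹ * (V 0 * ∫ x, b x ^ 2) := by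
          have := hV0 0
          gcongr
      _ = s * ∫ x, b x ^ 2 := by
          have := (hV0 0).ne'
          field_simp
      _ ≤ (a * ∫ x, ‖G x‖ ^ 2) + (s + lam) * ∫ x, b x ^ 2 := by
          have := mul_nonneg ha.le h3
          have := mul_nonneg hlam h4
          linarith
      _ = _ := by field_simp
  have hB0 : ¬ (fun x : E n => B ‖x‖) =ᵐ[volume] 0 := fun h => by
    obtain ⟨x, hx⟩ := h.exists
    exact (hB _ (norm_nonneg x)).ne' hx
  have hBq : EuclideanYamabe.quotient m s f lam (fun x : E n => B ‖x‖) X = a * A := by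
    refine le_antisymm ?_ (hlow hBS hB0)
    rw [hquot hBS, div_le_iff₀ (hD hBS hB0), mul_assoc]
    exact mul_le_mul_of_nonneg_left hmin ha.le
  have hA : EuclideanYamabe.A m s f lam = a * A := by
    refine IsLeast.csInf_eq ⟨⟨_, _, hBS, hB0, hBq.symm⟩, ?_⟩
    rintro _ ⟨b, G, hb, hb0, rfl⟩
    exact hlow hb hb0
  refine ⟨?_, _, X, hBS, hB0, fun x y hxy => ?_, hBq.trans hA.symm⟩
  · rw [hA, ← hBq]
    exact hlow' hBS hB0
  · exact hBa (Set.mem_Ici.2 (norm_nonneg x)) (Set.mem_Ici.2 (norm_nonneg y)) hxy
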